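/- Let $V:\mathbb{R}^2\to\mathbb{R}$ be a $C^1$ function that is not identically zero, with $V\ge 0$, and assume that there are $c>0$ and $\beta>10$ such that $$|V(x)|+|x\cdot\nabla V(x)|\le \frac{c}{\langle x\rangle^{\beta}}\qquad(x\in\mathbb{R}^2),\qquad \langle x\rangle=(1+|x|^2)^{1/2}.$$ Then: 1. If $c_0\in\mathbb{C}$, $\Psi_0\in L^q(\mathbb{R}^2;\mathbb{C})$ for some $q\in(2,\infty)$, and $\Psi=c_0+\Psi_0$ solves $-\Delta\Psi+V\Psi=0$ in the sense of distributions on $\mathbb{R}^2$, then $\Psi=0$ almost everywhere. 2. Consequently zero is not a resonance of $-\Delta+V$, that is, there is no solution $\Psi=c_0+\Psi_0$ as in 1 that is not almost everywhere zero. 3. Zero is a regular point of the spectrum of $-\Delta+V$: put $v=|V|^{1/2}$, $U(x)=1$ if $V(x)\ge0$ and $U(x)=-1$ if $V(x)<0$, and $(G_0f)(x)=-\frac1{2\pi}\int_{\mathbb{R}^2}\log|x-y|\,f(y)\,dy$. Then $v\in L^2(\mathbb{R}^2)$, $U+vG_0v$ is a bounded operator on $L^2(\mathbb{R}^2)$,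 and $Q(U+vG_0v)Q$ is invertible on $QL^2(\mathbb{R}^2)$, where $Q$ is the orthogonal projection of $L^2(\mathbb{R}^2)$ onto the orthogonal complement of $v$. -/

import Mathlib

open MeasureTheory
open scoped ENNReal ContDiff

noncomputable section

/-- The Euclidean plane `ℝ²`. -/
abbrev Plane : Type := EuclideanSpace ℝ (Fin 2)

/-- The Japanese bracket `⟨x⟩ = (1 + |x|²)^{1/2}`. -/
def japaneseBracket (x : Plane) : ℝ := Real.sqrt (1 + ‖x‖ ^ 2)

/-- The decay hypothesis with exponent `β`: `V` is a real valued `C¹` potential on `ℝ²` with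
`|V(x)| + |x · ∇V(x)| ≤ c ⟨x⟩^{-β}` for some `c > 0`. -/
def DecayingPotential (V : Plane → ℝ) (β : ℝ) : Prop :=
  ContDiff ℝ 1 V ∧
    ∃ c : ℝ, 0 < c ∧ ∀ x : Plane,
      |V x| + |inner ℝ x (gradient V x)| ≤ c / japaneseBracket x ^ β

/-- `u` is a solution of `-Δu + Vu = 0` on `ℝ²` in the sense of distributions. -/
def IsWeakSolution (V : Plane → ℝ) (u : Plane → ℂ) : Prop :=
  LocallyIntegrable u volume ∧
    ∀ φ : Plane → ℂ, ContDiff ℝ ∞ φ → HasCompactSupport φ →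
      ∫ x, u x * (-(Laplacian.laplacian φ x) + (V x : ℂ) * φ x) = 0

/-- `Ψ = c₀ + Ψ₀`, with `c₀ ∈ ℂ` and `Ψ₀ ∈ L^q(ℝ²)` for some `q ∈ (2, ∞)`, is a distributional
solution of `-ΔΨ + VΨ = 0`. -/
def IsResonanceSolution (V : Plane → ℝ) (c₀ : ℂ) (Ψ₀ : Plane → ℂ) : Prop :=
  (∃ q : ℝ≥0∞, 2 < q ∧ q < ⊤ ∧ MemLp Ψ₀ q volume) ∧
    IsWeakSolution V (fun x => c₀ + Ψ₀ x)

/-- Zero is a resonance of `-Δ + V`: there is a nontrivial solution of the above form. -/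
def ZeroIsResonance (V : Plane → ℝ) : Prop :=
  ∃ (c₀ : ℂ) (Ψ₀ : Plane → ℂ), IsResonanceSolution V c₀ Ψ₀ ∧
    ¬ ((fun x => c₀ + Ψ₀ x) =ᵐ[volume] 0)

/-- `(G₀ f)(x) = -(1/2π) ∫ log|x - y| f(y) dy`. -/
def logPotential (f : Plane → ℂ) (x : Plane) : ℂ :=
  -(1 / (2 * (Real.pi : ℂ))) * ∫ y, (Real.log ‖x - y‖ : ℂ) * f y

/-- `v = |V|^{1/2}`, as a complex valued function. -/
def sqrtAbs (V : Plane → ℝ) (x : Plane) : ℂ := (Real.sqrt |V x| : ℂ)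

open scoped Classical in
/-- The sign `U` of the potential: `1` where `V ≥ 0` and `-1` where `V < 0`. -/
def potentialSign (V : Plane → ℝ) (x : Plane) : ℂ := if 0 ≤ V x then 1 else -1

/-- Zero is a regular point of the spectrum of `-Δ + V`: `v` lies in `L²(ℝ²)`, the operator
`T = U + v G₀ v` is a bounded operator on `L²(ℝ²)`, and `Q T Q` is invertible on `Q L²(ℝ²)`, where
`Q = I - P_v` is the orthogonal projection onto the orthogonal complement of `v`.
(An operator `T` as below is determined uniquely by `V`.) -/
def ZeroIsRegularPoint (V : Plane → ℝ) : Prop :=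
  ∃ (hv : MemLp (sqrtAbs V) 2 volume)
    (T : Lp ℂ 2 (volume : Measure Plane) →L[ℂ] Lp ℂ 2 (volume : Measure Plane)),
    (∀ f : Lp ℂ 2 (volume : Measure Plane),
      T f =ᵐ[volume] fun x =>
        potentialSign V x * f x
          + sqrtAbs V x * logPotential (fun y => sqrtAbs V y * f y) x) ∧
    IsUnit
      (((Submodule.span ℂ {hv.toLp (sqrtAbs V)})ᗮ.orthogonalProjectionOnto.comp
        (T.comp (Submodule.span ℂ {hv.toLp (sqrtAbs V)})ᗮ.subtypeL)) :
          (Submodule.span ℂ {hv.toLp (sqrtAbs V)})ᗮ →L[ℂ]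
            (Submodule.span ℂ {hv.toLp (sqrtAbs V)})ᗮ)

end

/-- The Laplacian on the plane as a sum of iterated directional derivatives. -/
theorem laplacian_eq_sum_fderiv {F : Type*} [NormedAddCommGroup F] [NormedSpace ℝ F]
    {f : Plane → F} (hf : ContDiff ℝ ∞ f) (x : Plane) :
    Laplacian.laplacian f x = ∑ i : Fin 2,
      fderiv ℝ (fun y => fderiv ℝ f y (EuclideanSpace.basisFun (Fin 2) ℝ i)) x
        (EuclideanSpace.basisFun (Fin 2) ℝ i) := by
  rw [InnerProductSpace.laplacian_eq_iteratedFDeriv_orthonormalBasis f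
    (EuclideanSpace.basisFun (Fin 2) ℝ)]
  refine Finset.sum_congr rfl fun i _ => ?_
  rw [iteratedFDeriv_two_apply]
  have h : DifferentiableAt ℝ (fderiv ℝ f) x :=
    (hf.fderiv_right (m := ∞) (by simp)).differentiable (by simp) x
  rw [fderiv_clm_apply h (differentiableAt_const _)]
  simp

theorem contDiff_fderiv_apply {f : Plane → ℝ} (hf : ContDiff ℝ ∞ f) (v : Plane) :
    ContDiff ℝ ∞ (fun x => fderiv ℝ f x v) :=
  (hf.fderiv_right (m := ∞) (by simp)).clm_apply contDiff_const

theorem HasCompactSupport.fderiv_apply_const {f : Plane → ℝ} (hf : HasCompactSupport f)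
    (v : Plane) : HasCompactSupport (fun x => fderiv ℝ f x v) :=
  (hf.fderiv ℝ).comp_left (g := fun l : Plane →L[ℝ] ℝ => l v) (by simp)

theorem contDiff_laplacian {f : Plane → ℝ} (hf : ContDiff ℝ ∞ f) :
    ContDiff ℝ ∞ (Laplacian.laplacian f) := by
  have : Laplacian.laplacian f = fun x => ∑ i : Fin 2,
      fderiv ℝ (fun y => fderiv ℝ f y (EuclideanSpace.basisFun (Fin 2) ℝ i)) x
        (EuclideanSpace.basisFun (Fin 2) ℝ i) :=
    funext (laplacian_eq_sum_fderiv hf)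
  rw [this]
  exact ContDiff.sum fun i _ => contDiff_fderiv_apply (contDiff_fderiv_apply hf _) _

theorem HasCompactSupport.laplacian {f : Plane → ℝ} (hs : HasCompactSupport f)
    (hf : ContDiff ℝ ∞ f) : HasCompactSupport (Laplacian.laplacian f) := by
  have : Laplacian.laplacian f = fun x => ∑ i : Fin 2,
      fderiv ℝ (fun y => fderiv ℝ f y (EuclideanSpace.basisFun (Fin 2) ℝ i)) x
        (EuclideanSpace.basisFun (Fin 2) ℝ i) :=
    funext (laplacian_eq_sum_fderiv hf)
  rw [this]
  simp only [Fin.sum_univ_two]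
  exact ((hs.fderiv_apply_const _).fderiv_apply_const _).add
    ((hs.fderiv_apply_const _).fderiv_apply_const _)

/-- Rescaling and translating the argument, `y ↦ a • y + b`, multiplies the Laplacian by `a²`. -/
theorem laplacian_comp_smul_add {f : Plane → ℝ} (hf : ContDiff ℝ ∞ f) (a : ℝ) (b x : Plane) :
    Laplacian.laplacian (fun y => f (a • y + b)) x
      = a ^ 2 * Laplacian.laplacian f (a • x + b) := by
  have key : ∀ {h : Plane → ℝ}, ContDiff ℝ ∞ h → ∀ v y : Plane,
      fderiv ℝ (fun y => h (a • y + b)) y v = a * fderiv ℝ h (a • y + b) v := by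
    intro h hh v y
    have h1 : HasFDerivAt (fun y : Plane => a • y + b) (a • ContinuousLinearMap.id ℝ Plane) y :=
      ((hasFDerivAt_id y).const_smul a).add_const b
    have h2 := (hh.differentiable (by simp) (a • y + b)).hasFDerivAt.comp y h1
    have h3 : fderiv ℝ (fun y => h (a • y + b)) y = _ := h2.fderiv
    rw [h3]
    simp
  have hc : ContDiff ℝ ∞ (fun y => f (a • y + b)) :=
    hf.comp ((contDiff_const_smul a).add contDiff_const)
  rw [laplacian_eq_sum_fderiv (hc), laplacian_eq_sum_fderiv (hf),
    Finset.mul_sum]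
  refine Finset.sum_congr rfl fun i _ => ?_
  set v := EuclideanSpace.basisFun (Fin 2) ℝ i
  have : (fun y => fderiv ℝ (fun y => f (a • y + b)) y v)
      = a • fun y => (fun z => fderiv ℝ f z v) (a • y + b) := by
    funext y
    simp [key hf]
  have hd : DifferentiableAt ℝ (fun y => (fun z => fderiv ℝ f z v) (a • y + b)) x :=
    (((contDiff_fderiv_apply hf v).comp
      ((contDiff_const_smul a).add contDiff_const)).differentiable (by simp)) x
  rw [this, fderiv_const_smul hd, smul_apply,
    key (contDiff_fderiv_apply hf v), smul_eq_mul]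
  ring

open Convolution in
theorem fderiv_convolution_mul_apply {f η : Plane → ℝ} (hf : LocallyIntegrable f volume)
    (hη : ContDiff ℝ ∞ η) (hs : HasCompactSupport η) (x v : Plane) :
    fderiv ℝ (fun x => ∫ t, f t * η (x - t)) x v = ∫ t, f t * fderiv ℝ η (x - t) v := by
  have h := hs.hasFDerivAt_convolution_right (ContinuousLinearMap.mul ℝ ℝ) hf
    (hη.of_le (by simp)) x
  have h' : fderiv ℝ (fun x => ∫ t, f t * η (x - t)) x = _ := h.fderiv
  rw [h', convolution_precompR_apply _ hf (hs.fderiv ℝ) (hη.continuous_fderiv (by simp))]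
  rfl

open Convolution in
theorem contDiff_convolution_mul {f η : Plane → ℝ} (hf : LocallyIntegrable f volume)
    (hη : ContDiff ℝ ∞ η) (hs : HasCompactSupport η) :
    ContDiff ℝ ∞ (fun x => ∫ t, f t * η (x - t)) :=
  hs.contDiff_convolution_right (n := ⊤) (ContinuousLinearMap.mul ℝ ℝ) hf hη

open Convolution in
theorem integrable_convolution_mul_integrand {f η : Plane → ℝ} (hf : LocallyIntegrable f volume)
    (hη : Continuous η) (hs : HasCompactSupport η) (x : Plane) :
    Integrable (fun t => f t * η (x - t)) :=
  hs.convolutionExists_right (ContinuousLinearMap.mul ℝ ℝ) hf hη x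

theorem laplacian_convolution_mul {f η : Plane → ℝ} (hf : LocallyIntegrable f volume)
    (hη : ContDiff ℝ ∞ η) (hs : HasCompactSupport η) (x : Plane) :
    Laplacian.laplacian (fun x => ∫ t, f t * η (x - t)) x
      = ∫ t, f t * Laplacian.laplacian η (x - t) := by
  rw [laplacian_eq_sum_fderiv ((contDiff_convolution_mul hf hη hs))]
  have hd := fun v => contDiff_fderiv_apply hη v
  have hds := fun v => hs.fderiv_apply_const v
  simp only [fderiv_convolution_mul_apply hf hη hs, laplacian_eq_sum_fderiv (hη),
    Finset.mul_sum]
  rw [integral_finsetSum]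
  · exact Finset.sum_congr rfl fun i _ => fderiv_convolution_mul_apply hf (hd _) (hds _) x _
  · exact fun i _ => integrable_convolution_mul_integrand hf
      (contDiff_fderiv_apply (hd _) _).continuous ((hds _).fderiv_apply_const _) x

theorem integral_mul_fderiv_eq_neg {f g : Plane → ℝ} (hf : ContDiff ℝ ∞ f) (hg : ContDiff ℝ ∞ g)
    (hs : HasCompactSupport g) (v : Plane) :
    ∫ x, f x * fderiv ℝ g x v = -∫ x, fderiv ℝ f x v * g x := by
  apply integral_mul_fderiv_eq_neg_fderiv_mul_of_integrable
  · exact ((contDiff_fderiv_apply hf v).continuous.mul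
      hg.continuous).integrable_of_hasCompactSupport hs.mul_left
  · exact (hf.continuous.mul (contDiff_fderiv_apply hg v).continuous).integrable_of_hasCompactSupport
      (hs.fderiv_apply_const v).mul_left
  · exact (hf.continuous.mul hg.continuous).integrable_of_hasCompactSupport hs.mul_left
  · exact fun x _ => hf.differentiable (by simp) x
  · exact fun x _ => hg.differentiable (by simp) x

/-- `∫ u² Δχ = 2 ∫ |∇u|² χ + 2 ∫ u Δu χ`, with the gradient written in coordinates. -/
theorem integral_sq_mul_laplacian {u χ : Plane → ℝ} (hu : ContDiff ℝ ∞ u) (hχ : ContDiff ℝ ∞ χ)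
    (hs : HasCompactSupport χ) :
    ∫ x, u x ^ 2 * Laplacian.laplacian χ x
      = 2 * (∫ x, (∑ i : Fin 2,
          (fderiv ℝ u x (EuclideanSpace.basisFun (Fin 2) ℝ i)) ^ 2) * χ x)
        + 2 * ∫ x, u x * Laplacian.laplacian u x * χ x := by
  have hd := fun v => contDiff_fderiv_apply hu v
  have hdd := fun v => contDiff_fderiv_apply (hd v) v
  have key : ∀ v : Plane, ∫ x, u x ^ 2 * fderiv ℝ (fun y => fderiv ℝ χ y v) x v
      = 2 * (∫ x, (fderiv ℝ u x v) ^ 2 * χ x)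
        + 2 * ∫ x, u x * fderiv ℝ (fun y => fderiv ℝ u y v) x v * χ x := by
    intro v
    have hsq : ∀ x, fderiv ℝ (fun y => u y ^ 2) x v = 2 * u x * fderiv ℝ u x v := by
      intro x
      rw [fderiv_fun_pow 2 (hu.differentiable (by simp) x)]
      simp
    have hsq2 : ∀ x, fderiv ℝ (fun y => 2 * u y * fderiv ℝ u y v) x v
        = 2 * (fderiv ℝ u x v) ^ 2 + 2 * (u x * fderiv ℝ (fun y => fderiv ℝ u y v) x v) := by
      intro x
      have d1 : DifferentiableAt ℝ (fun y => 2 * u y) x :=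
        (hu.differentiable (by simp) x).const_mul 2
      rw [fderiv_fun_mul d1 ((hd v).differentiable (by simp) x),
        fderiv_const_mul (hu.differentiable (by simp) x)]
      simp
      ring
    rw [integral_mul_fderiv_eq_neg (hu.pow 2) (contDiff_fderiv_apply hχ v)
      (hs.fderiv_apply_const v)]
    simp only [hsq]
    rw [integral_mul_fderiv_eq_neg ((contDiff_const.mul hu).mul (hd v)) hχ hs, neg_neg]
    simp only [hsq2]
    rw [← integral_const_mul, ← integral_const_mul, ← integral_add]
    · congr 1
      ext x
      ring
    · exact ((((hd v).continuous.pow 2).mul hχ.continuous).integrable_of_hasCompactSupport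
        hs.mul_left).const_mul 2
    · exact ((((hu.continuous.mul (hdd v).continuous)).mul
        hχ.continuous).integrable_of_hasCompactSupport hs.mul_left).const_mul 2
  simp only [laplacian_eq_sum_fderiv (hχ), laplacian_eq_sum_fderiv (hu),
    Finset.mul_sum, Finset.sum_mul]
  rw [integral_finsetSum, integral_finsetSum, integral_finsetSum, Finset.mul_sum,
    Finset.mul_sum, ← Finset.sum_add_distrib]
  · exact Finset.sum_congr rfl fun i _ => key _
  · exact fun i _ => ((hu.continuous.mul (hdd _).continuous).mul
        hχ.continuous).integrable_of_hasCompactSupport hs.mul_left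
  · exact fun i _ => (((hd _).continuous.pow 2).mul
      hχ.continuous).integrable_of_hasCompactSupport hs.mul_left
  · exact fun i _ => ((hu.continuous.pow 2).mul (contDiff_fderiv_apply (contDiff_fderiv_apply hχ _)
      _).continuous).integrable_of_hasCompactSupport
        ((hs.fderiv_apply_const _).fderiv_apply_const _).mul_left

theorem integral_laplacian_eq_zero {χ : Plane → ℝ} (hχ : ContDiff ℝ ∞ χ)
    (hs : HasCompactSupport χ) : ∫ x, Laplacian.laplacian χ x = 0 := by
  have h := integral_sq_mul_laplacian (u := fun _ => 1) contDiff_const hχ hs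
  have h0 : Laplacian.laplacian (fun _ : Plane => (1 : ℝ)) = 0 :=
    InnerProductSpace.laplacian_const
  simpa [h0] using h

/-- Jensen's inequality under an integral: the `q`-th moment of an average is at most the average
of the `q`-th moments. -/
theorem lintegral_enorm_integral_rpow_le {α γ : Type*} [MeasurableSpace α] [MeasurableSpace γ]
    {μ : Measure α} {ν : Measure γ} [SFinite μ] [IsProbabilityMeasure ν] {q : ℝ} (hq : 1 ≤ q)
    {F : α → γ → ℝ} (hF : Measurable (Function.uncurry F)) :
    ∫⁻ x, ‖∫ t, F x t ∂ν‖ₑ ^ q ∂μ ≤ ∫⁻ t, ∫⁻ x, ‖F x t‖ₑ ^ q ∂μ ∂ν := by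
  have h0 : 0 < q := by linarith
  rw [lintegral_lintegral_swap (f := fun t x => ‖F x t‖ₑ ^ q)
    ((hF.comp measurable_swap).enorm.pow_const q).aemeasurable]
  refine lintegral_mono fun x => ?_
  have hm : AEStronglyMeasurable (F x) ν :=
    (hF.comp (measurable_const.prodMk measurable_id)).aestronglyMeasurable
  have h1 := eLpNorm'_le_eLpNorm'_of_exponent_le one_pos hq ν hm
  simp only [eLpNorm', ENNReal.rpow_one, div_one] at h1
  calc ‖∫ t, F x t ∂ν‖ₑ ^ q ≤ (∫⁻ t, ‖F x t‖ₑ ∂ν) ^ q := by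
        gcongr
        exact enorm_integral_le_lintegral_enorm _
    _ ≤ ((∫⁻ t, ‖F x t‖ₑ ^ q ∂ν) ^ (1 / q)) ^ q := by gcongr
    _ = ∫⁻ t, ‖F x t‖ₑ ^ q ∂ν := by
        rw [← ENNReal.rpow_mul, one_div_mul_cancel h0.ne', ENNReal.rpow_one]

/-- A bump function of total mass one, viewed as the density of a probability measure. -/
noncomputable def bumpMeasure (φ : ContDiffBump (0 : Plane)) : Measure Plane :=
  volume.withDensity fun t => ENNReal.ofReal (φ.normed volume t)

/-- The average of `f` against a normalised bump function. -/
noncomputable def mollify (φ : ContDiffBump (0 : Plane)) (f : Plane → ℝ) (x : Plane) : ℝ :=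
  ∫ t, f t * φ.normed volume (x - t)

instance (φ : ContDiffBump (0 : Plane)) : IsProbabilityMeasure (bumpMeasure φ) where
  measure_univ := by
    rw [bumpMeasure, withDensity_apply _ MeasurableSet.univ, setLIntegral_univ,
      ← ofReal_integral_eq_lintegral_ofReal φ.integrable_normed
        (Filter.Eventually.of_forall φ.nonneg_normed), φ.integral_normed, ENNReal.ofReal_one]

theorem bumpMeasure_compl_ball (φ : ContDiffBump (0 : Plane)) :
    ∀ᵐ t ∂bumpMeasure φ, ‖t‖ < φ.rOut := by
  rw [bumpMeasure, ae_withDensity_iff φ.continuous_normed.measurable.ennreal_ofReal]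
  refine Filter.Eventually.of_forall fun t ht => ?_
  have : t ∈ Function.support (φ.normed volume) := fun h => ht (by simp [h])
  rw [φ.support_normed_eq] at this
  simpa using this

theorem mollify_eq_integral_bumpMeasure (φ : ContDiffBump (0 : Plane)) (f : Plane → ℝ)
    (x : Plane) : mollify φ f x = ∫ t, f (x - t) ∂bumpMeasure φ := by
  rw [bumpMeasure, integral_withDensity_eq_integral_toReal_smul
    φ.continuous_normed.measurable.ennreal_ofReal (by simp), mollify,
    ← integral_sub_left_eq_self _ volume x]
  refine integral_congr_ae (Filter.Eventually.of_forall fun t => ?_)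
  simp [ENNReal.toReal_ofReal (φ.nonneg_normed t), mul_comm]

theorem mollify_congr_ae (φ : ContDiffBump (0 : Plane)) {f g : Plane → ℝ} (h : f =ᵐ[volume] g) :
    mollify φ f = mollify φ g := by
  funext x
  exact integral_congr_ae (h.mono fun t ht => by simp only [ht])

theorem contDiff_mollify (φ : ContDiffBump (0 : Plane)) {f : Plane → ℝ}
    (hf : LocallyIntegrable f volume) : ContDiff ℝ ∞ (mollify φ f) :=
  contDiff_convolution_mul hf φ.contDiff_normed φ.hasCompactSupport_normed

theorem memLp_mollify (φ : ContDiffBump (0 : Plane)) {f : Plane → ℝ} {q : ℝ≥0∞} (hq : 1 ≤ q)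
    (hq' : q ≠ ⊤) (hf : MemLp f q volume) : MemLp (mollify φ f) q volume := by
  have h0 : q ≠ 0 := (one_pos.trans_le hq).ne'
  have h1 : 1 ≤ q.toReal := by simpa using ENNReal.toReal_mono hq' hq
  refine ⟨(contDiff_mollify φ (hf.locallyIntegrable hq)).continuous.aestronglyMeasurable, ?_⟩
  obtain ⟨g, hg, hfg⟩ := hf.1
  rw [mollify_congr_ae φ hfg, eLpNorm_lt_top_iff_lintegral_rpow_enorm_lt_top h0 hq']
  have hg' : MemLp g q volume := (memLp_congr_ae hfg).1 hf
  have hgq := (eLpNorm_lt_top_iff_lintegral_rpow_enorm_lt_top h0 hq').1 hg'.2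
  simp only [mollify_eq_integral_bumpMeasure]
  refine (lintegral_enorm_integral_rpow_le h1
    (F := fun x t => g (x - t)) (hg.measurable.comp measurable_sub)).trans_lt ?_
  simp only [fun t => lintegral_sub_right_eq_self (μ := volume)
    (fun x => ‖g x‖ₑ ^ q.toReal) t, lintegral_const, measure_univ, mul_one]
  exact hgq

/-- Translations are continuous in `L²`. -/
theorem tendsto_eLpNorm_translate_sub {f : Plane → ℝ} (hf : MemLp f 2 volume) :
    Filter.Tendsto (fun t : Plane => eLpNorm (fun x => f (x - t) - f x) 2 volume)
      (nhds 0) (nhds 0) := by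
  let τ : Plane → C(Plane, Plane) := fun t => ⟨fun x => x - t, by fun_prop⟩
  have hτ : Continuous τ :=
    ContinuousMap.continuous_of_continuous_uncurry _ (continuous_snd.sub continuous_fst)
  have hm : ∀ t, MeasurePreserving (τ t) volume volume := fun t =>
    measurePreserving_sub_right volume t
  have hc : Continuous fun t => Lp.compMeasurePreserving (τ t) (hm t) (hf.toLp f) :=
    continuous_const.compMeasurePreservingLp hτ hm (by simp)
  have hlim := (hc.tendsto 0).sub (tendsto_const_nhds (x := hf.toLp f))
  have h0 : Lp.compMeasurePreserving (τ 0) (hm 0) (hf.toLp f) = hf.toLp f := by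
    rw [Lp.toLp_compMeasurePreserving]
    congr 1
    ext x
    simp [τ]
  rw [h0, sub_self] at hlim
  have h1 := (continuous_enorm.tendsto (0 : Lp ℝ 2 (volume : Measure Plane))).comp hlim
  rw [enorm_zero] at h1
  refine h1.congr fun t => ?_
  simp only [Function.comp_apply, Lp.toLp_compMeasurePreserving]
  rw [← MemLp.toLp_sub, Lp.enorm_def]
  refine eLpNorm_congr_ae ((MemLp.coeFn_toLp _).trans ?_)
  exact Filter.Eventually.of_forall fun x => rfl

theorem tendsto_eLpNorm_mollify_sub {φ : ℕ → ContDiffBump (0 : Plane)}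
    (hφ : Filter.Tendsto (fun n => (φ n).rOut) Filter.atTop (nhds 0)) {f : Plane → ℝ}
    (hf : MemLp f 2 volume) :
    Filter.Tendsto (fun n => eLpNorm (fun x => mollify (φ n) f x - f x) 2 volume)
      Filter.atTop (nhds 0) := by
  wlog hmeas : StronglyMeasurable f generalizing f
  · obtain ⟨g, hg, hfg⟩ := hf.1
    refine (this ((memLp_congr_ae hfg).1 hf) hg).congr fun n => ?_
    rw [mollify_congr_ae (φ n) hfg]
    exact eLpNorm_congr_ae (hfg.mono fun x hx => by simp only [hx])
  rw [ENNReal.tendsto_nhds_zero]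
  intro δ hδ
  have h := (ENNReal.tendsto_nhds_zero.1 (tendsto_eLpNorm_translate_sub hf)) δ hδ
  obtain ⟨ρ, hρ, hball⟩ := Metric.eventually_nhds_iff.1 h
  filter_upwards [hφ.eventually (gt_mem_nhds hρ)] with n hn
  have key : ∀ x, mollify (φ n) f x - f x = ∫ t, (f (x - t) - f x) ∂bumpMeasure (φ n) := by
    intro x
    rw [mollify_eq_integral_bumpMeasure]
    have hi : Integrable (fun t => f (x - t)) (bumpMeasure (φ n)) := by
      rw [bumpMeasure,
        integrable_withDensity_iff_integrable_smul'
        (φ n).continuous_normed.measurable.ennreal_ofReal (by simp)]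
      have := integrable_convolution_mul_integrand (hf.locallyIntegrable (by norm_num))
        ((φ n).continuous_normed (μ := volume)) (φ n).hasCompactSupport_normed x
      have h2 := (integrable_comp_sub_left _ x).2 this
      refine h2.congr (Filter.Eventually.of_forall fun t => ?_)
      simp [ENNReal.toReal_ofReal ((φ n).nonneg_normed t), mul_comm]
    rw [integral_sub hi (integrable_const _)]
    simp
  simp only [key]
  rw [eLpNorm_eq_lintegral_rpow_enorm_toReal (by norm_num) (by norm_num)]
  have hb : ∀ᵐ t ∂bumpMeasure (φ n),
      ∫⁻ x, ‖f (x - t) - f x‖ₑ ^ (2 : ℝ≥0∞).toReal ≤ δ ^ (2 : ℝ≥0∞).toReal := by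
    filter_upwards [bumpMeasure_compl_ball (φ n)] with t ht
    have h3 := hball (y := t) (by simpa using ht.trans hn)
    rw [eLpNorm_eq_lintegral_rpow_enorm_toReal (by norm_num) (by norm_num)] at h3
    have h4 := ENNReal.rpow_le_rpow h3 (z := (2 : ℝ≥0∞).toReal) (by simp)
    rwa [← ENNReal.rpow_mul, one_div_mul_cancel (by simp), ENNReal.rpow_one] at h4
  have h5 := (lintegral_enorm_integral_rpow_le (μ := volume) (ν := bumpMeasure (φ n))
    (q := (2 : ℝ≥0∞).toReal) (by simp) (F := fun x t => f (x - t) - f x)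
    ((hmeas.measurable.comp measurable_sub).sub
      (hmeas.measurable.comp measurable_fst))).trans (lintegral_mono_ae hb)
  rw [lintegral_const, measure_univ, mul_one] at h5
  have h6 := ENNReal.rpow_le_rpow h5 (z := 1 / (2 : ℝ≥0∞).toReal) (by simp)
  rwa [← ENNReal.rpow_mul δ, mul_one_div_cancel (by simp), ENNReal.rpow_one] at h6

/-- Integrals of products of functions converging in `L²` converge. -/
theorem tendsto_integral_mul_of_tendsto_eLpNorm {α : Type*} [MeasurableSpace α] {μ : Measure α}
    {f g : α → ℝ} {F G : ℕ → α → ℝ} (hf : MemLp f 2 μ) (hg : MemLp g 2 μ)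
    (hF : ∀ n, MemLp (F n) 2 μ) (hG : ∀ n, MemLp (G n) 2 μ)
    (hFf : Filter.Tendsto (fun n => eLpNorm (F n - f) 2 μ) Filter.atTop (nhds 0))
    (hGg : Filter.Tendsto (fun n => eLpNorm (G n - g) 2 μ) Filter.atTop (nhds 0)) :
    Filter.Tendsto (fun n => ∫ x, F n x * G n x ∂μ) Filter.atTop (nhds (∫ x, f x * g x ∂μ)) := by
  have h1 := (Lp.tendsto_Lp_iff_tendsto_eLpNorm'' F hF f hf).2 hFf
  have h2 := (Lp.tendsto_Lp_iff_tendsto_eLpNorm'' G hG g hg).2 hGg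
  have key : ∀ {u v : α → ℝ} (hu : MemLp u 2 μ) (hv : MemLp v 2 μ),
      inner ℝ (hv.toLp v) (hu.toLp u) = ∫ x, u x * v x ∂μ := by
    intro u v hu hv
    rw [L2.inner_def]
    refine integral_congr_ae ?_
    filter_upwards [hu.coeFn_toLp, hv.coeFn_toLp] with x hx hy
    simp [hx, hy]
  simpa only [key] using Filter.Tendsto.inner (𝕜 := ℝ) h2 h1

/-- A smooth cutoff equal to `1` on the ball of radius `n + 1`. -/
noncomputable def cutoff (n : ℕ) (x : Plane) : ℝ :=
  (⟨1, 2, one_pos, one_lt_two⟩ : ContDiffBump (0 : Plane)) (((n : ℝ) + 1)⁻¹ • x)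

theorem contDiff_cutoff (n : ℕ) : ContDiff ℝ ∞ (cutoff n) :=
  (ContDiffBump.contDiff _).comp (contDiff_const_smul _)

theorem hasCompactSupport_cutoff (n : ℕ) : HasCompactSupport (cutoff n) :=
  (ContDiffBump.hasCompactSupport _).comp_smul (by positivity)

theorem cutoff_nonneg (n : ℕ) (x : Plane) : 0 ≤ cutoff n x := ContDiffBump.nonneg _

theorem cutoff_eq_one {n : ℕ} {x : Plane} (hx : ‖x‖ ≤ n + 1) : cutoff n x = 1 := by
  refine ContDiffBump.one_of_mem_closedBall _ ?_
  have h : (0 : ℝ) < n + 1 := by positivity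
  rw [mem_closedBall_zero_iff, norm_smul, norm_inv, Real.norm_of_nonneg h.le]
  exact (inv_mul_le_one₀ h).2 hx

theorem exists_abs_laplacian_cutoff_le : ∃ M : ℝ, ∀ (n : ℕ) (x : Plane),
    |Laplacian.laplacian (cutoff n) x| ≤ M / ((n + 1) ^ 2 + ‖x‖ ^ 2) := by
  obtain ⟨θ, hθ, hθs, hcut⟩ : ∃ θ : Plane → ℝ, ContDiff ℝ ∞ θ ∧ HasCompactSupport θ ∧
      ∀ n, cutoff n = fun y => θ ((n + 1 : ℝ)⁻¹ • y) :=
    ⟨_, ContDiffBump.contDiff _, ContDiffBump.hasCompactSupport _, fun _ => rfl⟩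
  have hs : HasCompactSupport (fun y : Plane => (1 + ‖y‖ ^ 2) * Laplacian.laplacian θ y) :=
    (hθs.laplacian hθ).mul_left
  obtain ⟨M, hM⟩ := hs.exists_bound_of_continuous
    ((by fun_prop : Continuous fun y : Plane => 1 + ‖y‖ ^ 2).mul (contDiff_laplacian hθ).continuous)
  refine ⟨M, fun n x => ?_⟩
  have hn : (0 : ℝ) < n + 1 := by positivity
  have h := laplacian_comp_smul_add hθ ((n + 1 : ℝ)⁻¹) 0 x
  simp only [add_zero] at h
  have h1 := hM ((n + 1 : ℝ)⁻¹ • x)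
  rw [hcut, h, abs_mul, abs_of_nonneg (by positivity), le_div_iff₀ (by positivity)]
  rw [Real.norm_eq_abs, abs_mul, abs_of_nonneg (by positivity), norm_smul, norm_inv,
    Real.norm_of_nonneg hn.le] at h1
  refine le_trans (le_of_eq ?_) h1
  field_simp

theorem integrable_abs_rpow_div_one_add_norm_sq {g : Plane → ℝ} {q a : ℝ} (ha : 0 < a)
    (haq : a < q) (hg : AEStronglyMeasurable g volume) (hgq : Integrable fun x => |g x| ^ q) :
    Integrable fun x : Plane => |g x| ^ a / (1 + ‖x‖ ^ 2) := by
  have hp : 1 < q / a := (one_lt_div ha).2 haq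
  have hpq : (q / a).HolderConjugate (q / a).conjExponent := .conjExponent hp
  set r := (q / a).conjExponent
  have hr : 1 < r := hpq.symm.lt
  have hw : Integrable fun x : Plane => ((1 : ℝ) + ‖x‖ ^ 2) ^ (-(2 * r) / 2) :=
    integrable_rpow_neg_one_add_norm_sq (by simp; linarith)
  refine ((hgq.div_const (q / a)).add (hw.div_const r)).mono' ?_
    (Filter.Eventually.of_forall fun x => ?_)
  · exact (hg.norm.aemeasurable.pow_const a).aestronglyMeasurable.div₀
      (by fun_prop : Continuous fun x : Plane => 1 + ‖x‖ ^ 2).aestronglyMeasurable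
  · have h0 : (0 : ℝ) < 1 + ‖x‖ ^ 2 := by positivity
    have hy := Real.young_inequality_of_nonneg (a := |g x| ^ a) (b := (1 + ‖x‖ ^ 2)⁻¹)
      (by positivity) (by positivity) hpq
    rw [← Real.rpow_mul (abs_nonneg _), mul_div_cancel₀ _ ha.ne', Real.inv_rpow h0.le,
      ← Real.rpow_neg h0.le] at hy
    rw [Real.norm_of_nonneg (by positivity), div_eq_mul_inv]
    refine hy.trans (le_of_eq ?_)
    simp only [Pi.add_apply]
    congr 3
    ring

/-- If `g ∈ L^q` for some `2 < q < ∞`, then `∫ (c + g)² Δχ_n → 0` for the cutoffs `χ_n`. -/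
theorem tendsto_integral_sq_mul_laplacian_cutoff {g : Plane → ℝ} {q : ℝ≥0∞} (hq : 2 < q)
    (hq' : q ≠ ⊤) (hg : MemLp g q volume) (c : ℝ) :
    Filter.Tendsto (fun n => ∫ x, (c + g x) ^ 2 * Laplacian.laplacian (cutoff n) x)
      Filter.atTop (nhds 0) := by
  obtain ⟨M, hM⟩ := exists_abs_laplacian_cutoff_le
  have h2q : 2 < q.toReal := by simpa using (ENNReal.toReal_lt_toReal (by simp) hq').2 hq
  have hgq : Integrable fun x => |g x| ^ q.toReal :=
    hg.integrable_norm_rpow (pos_of_gt hq).ne' hq'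
  have hi1 := integrable_abs_rpow_div_one_add_norm_sq (a := 1) one_pos (by linarith) hg.1 hgq
  have hi2 := integrable_abs_rpow_div_one_add_norm_sq (a := 2) two_pos h2q hg.1 hgq
  simp only [Real.rpow_one, Real.rpow_two, sq_abs] at hi1 hi2
  have hM0 : 0 ≤ M := by
    have := (abs_nonneg _).trans (hM 0 0)
    simpa using this
  have hM1 : ∀ (n : ℕ) (x : Plane),
      |Laplacian.laplacian (cutoff n) x| ≤ M / (1 + ‖x‖ ^ 2) := by
    intro n x
    refine (hM n x).trans ?_
    gcongr
    nlinarith [(Nat.cast_nonneg n : (0 : ℝ) ≤ n)]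
  have hcont : ∀ n, Continuous (Laplacian.laplacian (cutoff n)) := fun n =>
    (contDiff_laplacian (contDiff_cutoff n)).continuous
  have hbound : ∀ (n : ℕ) (x : Plane),
      ‖(2 * c * g x + g x ^ 2) * Laplacian.laplacian (cutoff n) x‖
        ≤ M * (2 * |c| * (|g x| / (1 + ‖x‖ ^ 2)) + g x ^ 2 / (1 + ‖x‖ ^ 2)) := by
    intro n x
    rw [norm_mul, Real.norm_eq_abs, Real.norm_eq_abs]
    calc |2 * c * g x + g x ^ 2| * |Laplacian.laplacian (cutoff n) x|
        ≤ (2 * |c| * |g x| + g x ^ 2) * (M / (1 + ‖x‖ ^ 2)) := by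
          gcongr
          · refine (abs_add_le _ _).trans ?_
            rw [abs_mul, abs_mul, abs_two, abs_of_nonneg (sq_nonneg (g x))]
          · exact hM1 n x
      _ = _ := by ring
  have hbi : Integrable fun x : Plane =>
      M * (2 * |c| * (|g x| / (1 + ‖x‖ ^ 2)) + g x ^ 2 / (1 + ‖x‖ ^ 2)) :=
    ((hi1.const_mul _).add hi2).const_mul M
  have hmeas : ∀ n, AEStronglyMeasurable
      (fun x => (2 * c * g x + g x ^ 2) * Laplacian.laplacian (cutoff n) x) volume := fun n =>
    ((hg.1.const_mul (2 * c)).add (hg.1.pow 2)).mul (hcont n).aestronglyMeasurable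
  have hlim : Filter.Tendsto
      (fun n => ∫ x, (2 * c * g x + g x ^ 2) * Laplacian.laplacian (cutoff n) x)
      Filter.atTop (nhds (∫ _ : Plane, (0 : ℝ))) := by
    refine tendsto_integral_of_dominated_convergence _ hmeas hbi
      (fun n => Filter.Eventually.of_forall (hbound n)) (Filter.Eventually.of_forall fun x => ?_)
    suffices h : Filter.Tendsto (fun n => Laplacian.laplacian (cutoff n) x) Filter.atTop (nhds 0) by
      simpa only [mul_zero] using h.const_mul (2 * c * g x + g x ^ 2)
    have hup : Filter.Tendsto (fun n : ℕ => M / ((n : ℝ) + 1)) Filter.atTop (nhds 0) :=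
      tendsto_const_nhds.div_atTop
        (Filter.tendsto_atTop_add_const_right _ _ tendsto_natCast_atTop_atTop)
    refine squeeze_zero_norm (fun n => (hM n x).trans
      (div_le_div_of_nonneg_left hM0 (by positivity) ?_)) hup
    nlinarith [(Nat.cast_nonneg n : (0 : ℝ) ≤ n), sq_nonneg ‖x‖]
  rw [integral_zero] at hlim
  refine hlim.congr fun n => ?_
  have hsupp := (hasCompactSupport_cutoff n).laplacian (contDiff_cutoff n)
  have hsplit : ∀ x, (c + g x) ^ 2 * Laplacian.laplacian (cutoff n) x
      = c ^ 2 * Laplacian.laplacian (cutoff n) x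
        + (2 * c * g x + g x ^ 2) * Laplacian.laplacian (cutoff n) x := fun x => by ring
  simp only [hsplit]
  rw [integral_add (((hcont n).integrable_of_hasCompactSupport hsupp).const_mul _)
    (hbi.mono' (hmeas n) (Filter.Eventually.of_forall (hbound n))), integral_const_mul,
    integral_laplacian_eq_zero (contDiff_cutoff n) (hasCompactSupport_cutoff n)]
  simp

/-- If `-Δu + Vu = 0` weakly, then mollifying gives `Δ u_ε = (Vu)_ε`. -/
theorem laplacian_mollify_of_weak {V u : Plane → ℝ} (hV : Continuous V)
    (hu : LocallyIntegrable u volume)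
    (hw : ∀ φ : Plane → ℝ, ContDiff ℝ ∞ φ → HasCompactSupport φ →
      ∫ x, u x * (-(Laplacian.laplacian φ x) + V x * φ x) = 0)
    (φ : ContDiffBump (0 : Plane)) (x : Plane) :
    Laplacian.laplacian (mollify φ u) x = mollify φ (fun y => V y * u y) x := by
  set η : Plane → ℝ := φ.normed volume
  have hη : ContDiff ℝ ∞ η := φ.contDiff_normed
  have hs : HasCompactSupport η := φ.hasCompactSupport_normed
  have hVu : LocallyIntegrable (fun y => V y * u y) volume := by
    rw [← locallyIntegrableOn_univ] at hu ⊢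
    exact hu.continuousOn_mul hV.continuousOn isOpen_univ.isLocallyClosed
  have e : ∀ t, (-1 : ℝ) • t + x = x - t := fun t => by rw [neg_one_smul]; abel
  have hlap : ∀ t, Laplacian.laplacian (fun t => η (x - t)) t
      = Laplacian.laplacian η (x - t) := by
    intro t
    have h := laplacian_comp_smul_add hη (-1) x t
    simpa only [e, neg_one_sq, one_mul] using h
  have hsx : HasCompactSupport fun t => η (x - t) :=
    hs.comp_homeomorph (Homeomorph.subLeft x)
  have h := hw (fun t => η (x - t)) (hη.comp (contDiff_const.sub contDiff_id)) hsx
  simp only [hlap] at h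
  have h1 := integrable_convolution_mul_integrand hu (contDiff_laplacian hη).continuous
    (hs.laplacian hη) x
  have h2 := integrable_convolution_mul_integrand hVu hη.continuous hs x
  have h3 : Laplacian.laplacian (mollify φ u) x = ∫ t, u t * Laplacian.laplacian η (x - t) :=
    laplacian_convolution_mul hu hη hs x
  have h4 : ∀ t, u t * (-(Laplacian.laplacian η (x - t)) + V t * η (x - t))
      = V t * u t * η (x - t) - u t * Laplacian.laplacian η (x - t) := fun t => by ring
  simp only [h4] at h
  rw [integral_sub h2 h1, sub_eq_zero] at h
  rw [h3, ← h]
  rfl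

theorem tendsto_integral_mul_mul_of_tendsto_eLpNorm {α : Type*} [MeasurableSpace α]
    {μ : Measure α} {f g m : α → ℝ} {F G : ℕ → α → ℝ} (hf : MemLp f 2 μ) (hg : MemLp g 2 μ)
    (hF : ∀ n, MemLp (F n) 2 μ) (hG : ∀ n, MemLp (G n) 2 μ)
    (hm : AEStronglyMeasurable m μ) {C : ℝ} (hC : ∀ x, ‖m x‖ ≤ C)
    (hFf : Filter.Tendsto (fun n => eLpNorm (F n - f) 2 μ) Filter.atTop (nhds 0))
    (hGg : Filter.Tendsto (fun n => eLpNorm (G n - g) 2 μ) Filter.atTop (nhds 0)) :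
    Filter.Tendsto (fun n => ∫ x, F n x * (G n x * m x) ∂μ) Filter.atTop
      (nhds (∫ x, f x * (g x * m x) ∂μ)) := by
  have hmul : ∀ {h : α → ℝ}, MemLp h 2 μ → MemLp (fun x => h x * m x) 2 μ := fun hh =>
    hh.of_le_mul (c := C) (hh.1.mul hm) (Filter.Eventually.of_forall fun x => by
      rw [norm_mul, mul_comm]
      exact mul_le_mul_of_nonneg_right (hC x) (norm_nonneg _))
  refine tendsto_integral_mul_of_tendsto_eLpNorm hf (hmul hg) hF (fun n => hmul (hG n)) hFf ?_
  have hz : Filter.Tendsto (fun n => ENNReal.ofReal C * eLpNorm (G n - g) 2 μ) Filter.atTop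
      (nhds 0) := by
    simpa using ENNReal.Tendsto.const_mul hGg (Or.inr ENNReal.ofReal_ne_top)
  refine tendsto_of_tendsto_of_tendsto_of_le_of_le tendsto_const_nhds hz (fun _ => zero_le)
    fun n => eLpNorm_le_mul_eLpNorm_of_ae_le_mul (Filter.Eventually.of_forall fun x => ?_) 2
  simp only [Pi.sub_apply, ← sub_mul, norm_mul]
  rw [mul_comm]
  exact mul_le_mul_of_nonneg_right (hC x) (norm_nonneg _)

/-- Mollifiers with radius tending to zero. -/
noncomputable def shrinkingBump (n : ℕ) : ContDiffBump (0 : Plane) :=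
  ⟨1 / (2 * (n + 1)), 1 / (n + 1), by positivity, by
    apply one_div_lt_one_div_of_lt <;> nlinarith [(Nat.cast_nonneg n : (0 : ℝ) ≤ n)]⟩

theorem shrinkingBump_rOut (n : ℕ) : (shrinkingBump n).rOut = 1 / ((n : ℝ) + 1) := rfl

theorem tendsto_shrinkingBump_rOut :
    Filter.Tendsto (fun n => (shrinkingBump n).rOut) Filter.atTop (nhds 0) :=
  tendsto_one_div_add_atTop_nhds_zero_nat

theorem mollify_indicator_ball (φ : ContDiffBump (0 : Plane)) (hφ : φ.rOut ≤ 1) (f : Plane → ℝ)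
    {R : ℝ} {x : Plane} (hx : ‖x‖ ≤ R) :
    mollify φ ((Metric.ball 0 (R + 1)).indicator f) x = mollify φ f x := by
  refine integral_congr_ae (Filter.Eventually.of_forall fun t => ?_)
  by_cases ht : t ∈ Metric.ball (0 : Plane) (R + 1)
  · simp only [Set.indicator_of_mem ht]
  · have h0 : φ.normed volume (x - t) = 0 := by
      by_contra h
      have hmem : x - t ∈ Function.support (φ.normed volume) := h
      rw [φ.support_normed_eq, mem_ball_zero_iff] at hmem
      rw [mem_ball_zero_iff] at ht
      have := norm_sub_norm_le t x
      rw [norm_sub_rev] at this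
      linarith
    simp only [h0, mul_zero]

/-- If `-Δu + Vu = 0` weakly with `u ∈ L²_loc`, then `Δ(u²) ≥ 2Vu²` weakly. -/
theorem two_mul_integral_le_integral_sq_mul_laplacian {V u : Plane → ℝ} (hV : Continuous V)
    (hu : ∀ R : ℝ, MemLp ((Metric.ball 0 R).indicator u) 2 volume)
    (hul : LocallyIntegrable u volume)
    (hw : ∀ φ : Plane → ℝ, ContDiff ℝ ∞ φ → HasCompactSupport φ →
      ∫ x, u x * (-(Laplacian.laplacian φ x) + V x * φ x) = 0)
    {χ : Plane → ℝ} (hχ : ContDiff ℝ ∞ χ) (hs : HasCompactSupport χ) (hχ0 : ∀ x, 0 ≤ χ x) :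
    2 * ∫ x, V x * u x ^ 2 * χ x ≤ ∫ x, u x ^ 2 * Laplacian.laplacian χ x := by
  obtain ⟨R, hR⟩ : ∃ R : ℝ, tsupport χ ⊆ Metric.closedBall 0 R :=
    hs.isCompact.isBounded.subset_closedBall 0
  have hχR : ∀ x, R < ‖x‖ → χ x = 0 := fun x hx => by
    refine image_eq_zero_of_notMem_tsupport fun h => ?_
    have := hR h
    rw [mem_closedBall_zero_iff] at this
    linarith
  have hLR : ∀ x, R < ‖x‖ → Laplacian.laplacian χ x = 0 := fun x hx => by
    have h0 : χ =ᶠ[nhds x] fun _ => 0 := by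
      filter_upwards [(continuous_norm.continuousAt (x := x)).eventually (lt_mem_nhds hx)]
        with y hy using hχR y hy
    have h1 := InnerProductSpace.laplacian_congr_nhds h0
    have h2 : Laplacian.laplacian (fun _ : Plane => (0 : ℝ)) = 0 :=
      InnerProductSpace.laplacian_const
    rw [h1.eq_of_nhds, h2, Pi.zero_apply]
  set f := (Metric.ball (0 : Plane) (R + 1)).indicator u
  have hf : MemLp f 2 volume := hu _
  have hfu : ∀ x, ‖x‖ ≤ R → f x = u x := fun x hx =>
    Set.indicator_of_mem (by rw [mem_ball_zero_iff]; linarith) u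
  set h := (Metric.ball (0 : Plane) (R + 1)).indicator fun x => V x * u x
  have hhf : h = fun x => V x * f x := by
    funext x
    by_cases hx : x ∈ Metric.ball (0 : Plane) (R + 1)
    · simp only [h, f, Set.indicator_of_mem hx]
    · simp only [h, f, Set.indicator_of_notMem hx, mul_zero]
  obtain ⟨B, hB⟩ := (isCompact_closedBall (0 : Plane) (R + 1)).exists_bound_of_continuousOn
    hV.continuousOn
  have hh : MemLp h 2 volume := by
    refine hf.of_le_mul (c := B) (hhf ▸ hV.aestronglyMeasurable.mul hf.1)
      (Filter.Eventually.of_forall fun x => ?_)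
    by_cases hx : x ∈ Metric.ball (0 : Plane) (R + 1)
    · rw [hhf, norm_mul]
      exact mul_le_mul_of_nonneg_right (hB x (Metric.ball_subset_closedBall hx)) (norm_nonneg _)
    · simp only [h, f, Set.indicator_of_notMem hx, norm_zero, mul_zero, le_refl]
  obtain ⟨C₁, hC₁⟩ := hs.exists_bound_of_continuous hχ.continuous
  have hLc := (contDiff_laplacian hχ).continuous
  obtain ⟨C₂, hC₂⟩ := (hs.laplacian hχ).exists_bound_of_continuous hLc
  have hφ1 : ∀ n, (shrinkingBump n).rOut ≤ 1 := fun n => by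
    rw [shrinkingBump_rOut, div_le_one (by positivity)]
    linarith [(Nat.cast_nonneg n : (0 : ℝ) ≤ n)]
  have hfn := fun n => memLp_mollify (shrinkingBump n) one_le_two (by simp) hf
  have hhn := fun n => memLp_mollify (shrinkingBump n) one_le_two (by simp) hh
  have cf := tendsto_eLpNorm_mollify_sub tendsto_shrinkingBump_rOut hf
  have ch := tendsto_eLpNorm_mollify_sub tendsto_shrinkingBump_rOut hh
  have L1 := tendsto_integral_mul_mul_of_tendsto_eLpNorm hf hf hfn hfn hLc.aestronglyMeasurable
    hC₂ cf cf
  have L2 := (tendsto_integral_mul_mul_of_tendsto_eLpNorm hf hh hfn hhn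
    hχ.continuous.aestronglyMeasurable hC₁ cf ch).const_mul 2
  have hstep : ∀ n, 2 * ∫ x, mollify (shrinkingBump n) f x * (mollify (shrinkingBump n) h x * χ x)
      ≤ ∫ x, mollify (shrinkingBump n) f x
        * (mollify (shrinkingBump n) f x * Laplacian.laplacian χ x) := by
    intro n
    set φ := shrinkingBump n
    have hG := integral_sq_mul_laplacian (contDiff_mollify φ hul) hχ hs
    have hpos : 0 ≤ ∫ x, (∑ i : Fin 2,
        (fderiv ℝ (mollify φ u) x (EuclideanSpace.basisFun (Fin 2) ℝ i)) ^ 2) * χ x :=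
      integral_nonneg fun x => mul_nonneg (Finset.sum_nonneg fun i _ => sq_nonneg _) (hχ0 x)
    have e1 : ∫ x, mollify φ f x * (mollify φ f x * Laplacian.laplacian χ x)
        = ∫ x, mollify φ u x ^ 2 * Laplacian.laplacian χ x := by
      congr 1
      funext x
      rcases le_or_gt ‖x‖ R with hx | hx
      · rw [mollify_indicator_ball φ (hφ1 n) u hx]
        ring
      · simp only [hLR x hx, mul_zero]
    have e2 : ∫ x, mollify φ f x * (mollify φ h x * χ x)
        = ∫ x, mollify φ u x * Laplacian.laplacian (mollify φ u) x * χ x := by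
      congr 1
      funext x
      rcases le_or_gt ‖x‖ R with hx | hx
      · rw [mollify_indicator_ball φ (hφ1 n) u hx, mollify_indicator_ball φ (hφ1 n) _ hx,
          laplacian_mollify_of_weak hV hul hw]
        ring
      · simp only [hχR x hx, mul_zero]
    rw [e1, e2]
    linarith
  have e3 : ∫ x, f x * (h x * χ x) = ∫ x, V x * u x ^ 2 * χ x := by
    congr 1
    funext x
    rcases le_or_gt ‖x‖ R with hx | hx
    · rw [hhf]
      simp only [hfu x hx]
      ring
    · simp only [hχR x hx, mul_zero]
  have e4 : ∫ x, f x * (f x * Laplacian.laplacian χ x)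
      = ∫ x, u x ^ 2 * Laplacian.laplacian χ x := by
    congr 1
    funext x
    rcases le_or_gt ‖x‖ R with hx | hx
    · rw [hfu x hx]
      ring
    · simp only [hLR x hx, mul_zero]
  rw [← e3, ← e4]
  exact le_of_tendsto_of_tendsto' L2 L1 hstep

theorem ae_eq_zero_of_integral_mul_cutoff_le {W : Plane → ℝ} (hW : ∀ x, 0 ≤ W x)
    (hWl : LocallyIntegrable W volume) {a : ℕ → ℝ}
    (hle : ∀ n, ∫ x, W x * cutoff n x ≤ a n) (ha : Filter.Tendsto a Filter.atTop (nhds 0)) :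
    W =ᵐ[volume] 0 := by
  have hk : ∀ k : ℕ, ∀ᵐ x ∂volume, x ∈ Metric.closedBall (0 : Plane) k → W x = 0 := by
    intro k
    have hi := hWl.integrableOn_isCompact (isCompact_closedBall (0 : Plane) k)
    have h0 : ∫ x in Metric.closedBall (0 : Plane) k, W x ≤ 0 := by
      refine ge_of_tendsto ha ?_
      filter_upwards [Filter.eventually_ge_atTop k] with n hn
      refine le_trans ?_ (hle n)
      rw [← integral_indicator Metric.isClosed_closedBall.measurableSet]
      have hint : Integrable fun x => W x * cutoff n x :=
        hWl.integrable_smul_right_of_hasCompactSupport (contDiff_cutoff n).continuous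
          (hasCompactSupport_cutoff n)
      refine integral_mono (hi.integrable_indicator Metric.isClosed_closedBall.measurableSet)
        hint fun x => ?_
      by_cases hx : x ∈ Metric.closedBall (0 : Plane) k
      · rw [mem_closedBall_zero_iff] at hx
        have hkn : (k : ℝ) ≤ n := by exact_mod_cast hn
        rw [Set.indicator_of_mem (by simpa using hx), cutoff_eq_one (by linarith), mul_one]
      · rw [Set.indicator_of_notMem hx]
        exact mul_nonneg (hW x) (cutoff_nonneg n x)
    have h1 : ∫ x in Metric.closedBall (0 : Plane) k, W x = 0 :=
      le_antisymm h0 (integral_nonneg hW)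
    rw [integral_eq_zero_iff_of_nonneg hW hi] at h1
    exact (ae_restrict_iff' Metric.isClosed_closedBall.measurableSet).1 h1
  filter_upwards [ae_all_iff.2 hk] with x hx
  obtain ⟨k, hkx⟩ := exists_nat_ge ‖x‖
  exact hx k (by simpa using hkx)

/-- Liouville property: a weak solution `c + g` of `-Δu + Vu = 0` with `g ∈ L^q`, `2 < q < ∞`, and
a nonnegative nonzero potential vanishes. -/
theorem ae_eq_zero_of_weak_solution {V g : Plane → ℝ} (hV : Continuous V) (hV0 : ∀ x, 0 ≤ V x)
    (hVne : V ≠ 0) {q : ℝ≥0∞} (hq : 2 < q) (hq' : q ≠ ⊤) (hg : MemLp g q volume) (c : ℝ)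
    (hw : ∀ φ : Plane → ℝ, ContDiff ℝ ∞ φ → HasCompactSupport φ →
      ∫ x, (c + g x) * (-(Laplacian.laplacian φ x) + V x * φ x) = 0) :
    (fun x => c + g x) =ᵐ[volume] 0 := by
  have hq1 : 1 ≤ q := one_le_two.trans hq.le
  set u : Plane → ℝ := fun x => c + g x
  have hgl : LocallyIntegrable g volume := hg.locallyIntegrable hq1
  have hul : LocallyIntegrable u volume := (locallyIntegrable_const c).add hgl
  have hu2 : ∀ R : ℝ, MemLp ((Metric.ball 0 R).indicator u) 2 volume := by
    intro R
    rw [memLp_indicator_iff_restrict measurableSet_ball]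
    have : IsFiniteMeasure (volume.restrict (Metric.ball (0 : Plane) R)) :=
      ⟨by simpa using measure_ball_lt_top (μ := volume) (x := (0 : Plane)) (r := R)⟩
    exact (memLp_const c).add ((hg.restrict _).mono_exponent hq.le)
  have husq : LocallyIntegrable (fun x => u x ^ 2) volume := by
    rw [locallyIntegrable_iff]
    intro K hK
    obtain ⟨R, hR⟩ := hK.isBounded.subset_ball (0 : Plane)
    have h := ((memLp_indicator_iff_restrict measurableSet_ball).1 (hu2 R)).integrable_sq
    exact IntegrableOn.mono_set h hR
  have hlim := tendsto_integral_sq_mul_laplacian_cutoff hq hq' hg c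
  have hVu2 : (fun x => V x * u x ^ 2) =ᵐ[volume] 0 := by
    refine ae_eq_zero_of_integral_mul_cutoff_le (fun x => mul_nonneg (hV0 x) (sq_nonneg _)) ?_
      (a := fun n => 2⁻¹ * ∫ x, u x ^ 2 * Laplacian.laplacian (cutoff n) x) (fun n => ?_)
      (by simpa using hlim.const_mul 2⁻¹)
    · rw [← locallyIntegrableOn_univ] at husq ⊢
      exact husq.continuousOn_mul hV.continuousOn isOpen_univ.isLocallyClosed
    · have := two_mul_integral_le_integral_sq_mul_laplacian hV hu2 hul hw (contDiff_cutoff n)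
        (hasCompactSupport_cutoff n) (cutoff_nonneg n)
      linarith
  have hVu : (fun x => V x * u x) =ᵐ[volume] 0 := by
    filter_upwards [hVu2] with x hx
    simpa using hx
  have hconst : ∀ (φ : ContDiffBump (0 : Plane)) (x y : Plane),
      mollify φ u x = mollify φ u y := by
    intro φ
    have hsm := contDiff_mollify φ hul
    have hharm : ∀ x, Laplacian.laplacian (mollify φ u) x = 0 := by
      intro x
      rw [laplacian_mollify_of_weak hV hul hw, mollify_congr_ae φ hVu]
      simp [mollify]
    have hsplit : mollify φ u = fun x => c + mollify φ g x := by
      funext x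
      have hη := (φ.continuous_normed (μ := volume))
      have h1 := integrable_convolution_mul_integrand (locallyIntegrable_const c) hη
        φ.hasCompactSupport_normed x
      have h2 := integrable_convolution_mul_integrand hgl hη φ.hasCompactSupport_normed x
      simp only [mollify, u, add_mul]
      rw [integral_add h1 h2, integral_const_mul, integral_sub_left_eq_self, φ.integral_normed,
        mul_one]
    have hgrad : (fun x => ∑ i : Fin 2,
        (fderiv ℝ (mollify φ u) x (EuclideanSpace.basisFun (Fin 2) ℝ i)) ^ 2) = 0 := by
      have hc : Continuous fun x => ∑ i : Fin 2,
          (fderiv ℝ (mollify φ u) x (EuclideanSpace.basisFun (Fin 2) ℝ i)) ^ 2 :=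
        continuous_finsetSum _ fun i _ => (contDiff_fderiv_apply hsm _).continuous.pow 2
      refine (hc.ae_eq_iff_eq volume continuous_zero).1 ?_
      have hl := (tendsto_integral_sq_mul_laplacian_cutoff hq hq'
        (memLp_mollify φ hq1 hq' hg) c).const_mul 2⁻¹
      rw [mul_zero] at hl
      refine ae_eq_zero_of_integral_mul_cutoff_le
        (fun x => Finset.sum_nonneg fun i _ => sq_nonneg _) hc.locallyIntegrable
        (fun n => ?_) hl
      have hG := integral_sq_mul_laplacian hsm (contDiff_cutoff n) (hasCompactSupport_cutoff n)
      simp only [hharm, mul_zero, zero_mul, integral_zero, add_zero] at hG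
      have e : ∀ x, c + mollify φ g x = mollify φ u x := fun x => (congrFun hsplit x).symm
      simp only [e]
      linarith
    have hfd : ∀ x, fderiv ℝ (mollify φ u) x = 0 := by
      intro x
      have hx := congrFun hgrad x
      rw [Pi.zero_apply, Finset.sum_eq_zero_iff_of_nonneg fun i _ => sq_nonneg _] at hx
      refine ContinuousLinearMap.coe_injective
        ((EuclideanSpace.basisFun (Fin 2) ℝ).toBasis.ext fun i => ?_)
      simpa using hx i (Finset.mem_univ i)
    exact is_const_of_fderiv_eq_zero (hsm.differentiable (by simp)) hfd
  have hae : ∀ᵐ x ∂volume, Filter.Tendsto (fun n => mollify (shrinkingBump n) u x)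
      Filter.atTop (nhds (u x)) := by
    have h := ContDiffBump.ae_convolution_tendsto_right_of_locallyIntegrable (μ := volume) (K := 2)
      tendsto_shrinkingBump_rOut (Filter.Eventually.of_forall fun n => ?_) hul
    · filter_upwards [h] with x hx
      refine hx.congr fun n => ?_
      rw [convolution_lsmul_swap]
      exact integral_congr_ae (Filter.Eventually.of_forall fun t => mul_comm _ _)
    · simp only [shrinkingBump]
      apply le_of_eq
      field_simp
  obtain ⟨x₀, hx₀⟩ := hae.exists
  have huc : ∀ᵐ x ∂volume, u x = u x₀ := by
    filter_upwards [hae] with x hx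
    exact tendsto_nhds_unique (hx.congr fun n => hconst _ x x₀) hx₀
  by_cases hk : u x₀ = 0
  · filter_upwards [huc] with x hx
    rw [hx, hk, Pi.zero_apply]
  · refine absurd ?_ hVne
    refine (hV.ae_eq_iff_eq volume continuous_zero).1 ?_
    filter_upwards [huc, hVu] with x hx hx'
    rw [hx] at hx'
    exact (mul_eq_zero.1 hx').resolve_right hk

theorem IsResonanceSolution.ae_eq_zero {V : Plane → ℝ} (hV : Continuous V) (hV0 : ∀ x, 0 ≤ V x)
    (hVne : V ≠ 0) {c₀ : ℂ} {Ψ₀ : Plane → ℂ} (h : IsResonanceSolution V c₀ Ψ₀) :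
    (fun x => c₀ + Ψ₀ x) =ᵐ[volume] 0 := by
  obtain ⟨⟨q, hq, hq', hΨ⟩, hloc, hw⟩ := h
  have key : ∀ l : ℂ →L[ℝ] ℝ, (fun x => l c₀ + l (Ψ₀ x)) =ᵐ[volume] 0 := by
    intro l
    refine ae_eq_zero_of_weak_solution hV hV0 hVne hq hq'.ne (l.comp_memLp' hΨ) (l c₀)
      fun φ hφ hs => ?_
    have hlap : ∀ x, Laplacian.laplacian (fun y => (φ y : ℂ)) x = (Laplacian.laplacian φ x : ℂ) :=
      fun x => (contDiff_infty.1 hφ 2).contDiffAt.laplacian_CLM_comp_left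
        (l := Complex.ofRealCLM)
    have h1 := hw (fun y => (φ y : ℂ)) (Complex.ofRealCLM.contDiff.comp hφ)
      (hs.comp_left (g := fun r : ℝ => (r : ℂ)) rfl)
    set m : Plane → ℝ := fun x => -(Laplacian.laplacian φ x) + V x * φ x
    have hmc : Continuous m :=
      (contDiff_laplacian hφ).continuous.neg.add (hV.mul hφ.continuous)
    have hms : HasCompactSupport m := (hs.laplacian hφ).neg.add hs.mul_left
    have e : ∀ x, (c₀ + Ψ₀ x) * (-(Laplacian.laplacian (fun y => (φ y : ℂ)) x)
        + (V x : ℂ) * (φ x : ℂ)) = m x • (c₀ + Ψ₀ x) := by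
      intro x
      rw [hlap, Complex.real_smul]
      simp only [m]
      push_cast
      ring
    simp only [e] at h1
    have hi : Integrable fun x => m x • (c₀ + Ψ₀ x) :=
      hloc.integrable_smul_left_of_hasCompactSupport hmc hms
    have h2 := l.integral_comp_comm hi
    rw [h1, map_zero] at h2
    rw [← h2]
    congr 1
    funext x
    rw [map_smul, map_add, smul_eq_mul, mul_comm]
    rfl
  filter_upwards [key Complex.reCLM, key Complex.imCLM] with x hre him
  exact Complex.ext (by simpa using hre) (by simpa using him)

section HilbertSchmidt

variable {α : Type*} [MeasurableSpace α] {μ : Measure α} [SFinite μ] {K : α × α → ℂ}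

theorem integrable_kernel_mul (hK : MemLp K 2 (μ.prod μ)) {f : α → ℂ} (hf : MemLp f 2 μ) :
    ∀ᵐ x ∂μ, Integrable (fun y => K (x, y) * f y) μ := by
  have h1 := (memLp_two_iff_integrable_sq_norm hK.1).1 hK
  filter_upwards [h1.prod_right_ae, hK.1.prodMk_left] with x hx hm
  exact MemLp.integrable_mul ((memLp_two_iff_integrable_sq_norm hm).2 hx) hf

theorem eLpNorm_integral_kernel_le (hK : MemLp K 2 (μ.prod μ)) {f : α → ℂ} (hf : MemLp f 2 μ) :
    eLpNorm (fun x => ∫ y, K (x, y) * f y ∂μ) 2 μ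
      ≤ eLpNorm K 2 (μ.prod μ) * eLpNorm f 2 μ := by
  have hpt : ∀ᵐ x ∂μ, ‖∫ y, K (x, y) * f y ∂μ‖ₑ ^ (2 : ℝ)
      ≤ (∫⁻ y, ‖K (x, y)‖ₑ ^ (2 : ℝ) ∂μ) * ∫⁻ y, ‖f y‖ₑ ^ (2 : ℝ) ∂μ := by
    filter_upwards [hK.1.prodMk_left] with x hm
    have h1 := ENNReal.lintegral_mul_le_Lp_mul_Lq μ Real.HolderConjugate.two_two
      hm.enorm hf.1.enorm
    have h2 : ‖∫ y, K (x, y) * f y ∂μ‖ₑ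
        ≤ (∫⁻ y, ‖K (x, y)‖ₑ ^ (2 : ℝ) ∂μ) ^ (1 / (2 : ℝ))
          * (∫⁻ y, ‖f y‖ₑ ^ (2 : ℝ) ∂μ) ^ (1 / (2 : ℝ)) := by
      refine (enorm_integral_le_lintegral_enorm _).trans (le_trans (le_of_eq ?_) h1)
      simp only [enorm_mul, Pi.mul_apply]
    refine (ENNReal.rpow_le_rpow h2 zero_le_two).trans (le_of_eq ?_)
    rw [ENNReal.mul_rpow_of_nonneg _ _ zero_le_two, ← ENNReal.rpow_mul, ← ENNReal.rpow_mul]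
    norm_num
  simp only [eLpNorm_eq_lintegral_rpow_enorm_toReal two_ne_zero ENNReal.ofNat_ne_top,
    ENNReal.toReal_ofNat]
  rw [← ENNReal.mul_rpow_of_nonneg _ _ (by norm_num)]
  gcongr
  refine (lintegral_mono_ae hpt).trans (le_of_eq ?_)
  rw [lintegral_mul_const'' _ ?_, lintegral_prod _ (hK.1.enorm.pow_const _)]
  exact (hK.1.enorm.pow_const _).lintegral_prod_right'

theorem memLp_integral_kernel (hK : MemLp K 2 (μ.prod μ)) {f : α → ℂ} (hf : MemLp f 2 μ) :
    MemLp (fun x => ∫ y, K (x, y) * f y ∂μ) 2 μ :=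
  ⟨(hK.1.mul (hf.1.comp_snd (μ := μ))).integral_prod_right',
    (eLpNorm_integral_kernel_le hK hf).trans_lt (ENNReal.mul_lt_top hK.2 hf.2)⟩

/-- A square integrable kernel defines a bounded operator on `L²`. -/
theorem exists_clm_integral_kernel (hK : MemLp K 2 (μ.prod μ)) :
    ∃ T : Lp ℂ 2 μ →L[ℂ] Lp ℂ 2 μ, ∀ f : Lp ℂ 2 μ,
      T f =ᵐ[μ] fun x => ∫ y, K (x, y) * f y ∂μ := by
  have hm := fun f : Lp ℂ 2 μ => memLp_integral_kernel hK (Lp.memLp f)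
  let T₀ : Lp ℂ 2 μ →ₗ[ℂ] Lp ℂ 2 μ :=
    { toFun := fun f => (hm f).toLp _
      map_add' := fun f g => by
        rw [← MemLp.toLp_add]
        refine MemLp.toLp_congr _ _ ?_
        filter_upwards [integrable_kernel_mul hK (Lp.memLp f),
          integrable_kernel_mul hK (Lp.memLp g)] with x hf hg
        rw [Pi.add_apply, ← integral_add hf hg]
        refine integral_congr_ae ?_
        filter_upwards [Lp.coeFn_add f g] with y hy
        rw [hy, Pi.add_apply, mul_add]
      map_smul' := fun c f => by
        rw [RingHom.id_apply, ← MemLp.toLp_const_smul]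
        refine MemLp.toLp_congr _ _ (Filter.Eventually.of_forall fun x => ?_)
        simp only [Pi.smul_apply, smul_eq_mul]
        rw [← integral_const_mul]
        refine integral_congr_ae ?_
        filter_upwards [Lp.coeFn_smul c f] with y hy
        rw [hy, Pi.smul_apply, smul_eq_mul]
        ring }
  refine ⟨T₀.mkContinuous (eLpNorm K 2 (μ.prod μ)).toReal fun f => ?_,
    fun f => (hm f).coeFn_toLp⟩
  change ‖(hm f).toLp _‖ ≤ _
  rw [Lp.norm_toLp, Lp.norm_def, ← ENNReal.toReal_mul]
  exact ENNReal.toReal_mono (ENNReal.mul_ne_top hK.2.ne (Lp.eLpNorm_ne_top f))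
    (eLpNorm_integral_kernel_le hK (Lp.memLp f))

end HilbertSchmidt

theorem integrableOn_exp_sub_exp_div {a b : ℝ} (ha : 0 < a) (hb : 0 < b) :
    IntegrableOn (fun t : ℝ => t⁻¹ * (Real.exp (-(a * t)) - Real.exp (-(b * t)))) (Set.Ioi 0) := by
  wlog hab : a ≤ b generalizing a b
  · refine (this hb ha (le_of_not_ge hab)).neg.congr (Filter.Eventually.of_forall fun t => ?_)
    simp only [Pi.neg_apply]
    ring
  have hi : IntegrableOn (fun t : ℝ => (b - a) * Real.exp (-a * t)) (Set.Ioi 0) :=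
    (integrableOn_exp_mul_Ioi (neg_lt_zero.2 ha) 0).const_mul (b - a)
  refine hi.mono' (by fun_prop) ((ae_restrict_iff' measurableSet_Ioi).2
    (Filter.Eventually.of_forall fun t ht => ?_))
  have ht0 : (0 : ℝ) < t := ht
  have h1 : Real.exp (-(b * t)) ≤ Real.exp (-(a * t)) :=
    Real.exp_le_exp.2 (neg_le_neg (mul_le_mul_of_nonneg_right hab ht0.le))
  have h2 : Real.exp (-(b * t)) = Real.exp (-(a * t)) * Real.exp (-((b - a) * t)) := by
    rw [← Real.exp_add]
    ring_nf
  have h3 := Real.add_one_le_exp (-((b - a) * t))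
  rw [Real.norm_of_nonneg (mul_nonneg (inv_nonneg.2 ht0.le) (sub_nonneg.2 h1)),
    inv_mul_le_iff₀ ht0, h2, neg_mul]
  nlinarith [Real.exp_pos (-(a * t))]

theorem integral_exp_sub_exp_div {a b : ℝ} (ha : 0 < a) (hb : 0 < b) :
    ∫ t in Set.Ioi (0 : ℝ), t⁻¹ * (Real.exp (-(a * t)) - Real.exp (-(b * t)))
      = Real.log (b / a) := by
  have h := Frullani.integral_Ioi_eq (f := fun t : ℝ => Real.exp (-t)) (L := 1) (R := 0)
    ((by fun_prop : Continuous fun t : ℝ => Real.exp (-t)).locallyIntegrable.locallyIntegrableOn _)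
    ha hb ?_ (Real.tendsto_exp_neg_atTop_nhds_zero) (integrableOn_exp_sub_exp_div ha hb)
  · simpa using h
  · have hc : Continuous fun t : ℝ => Real.exp (-t) := by fun_prop
    have := hc.tendsto 0
    rw [neg_zero, Real.exp_zero] at this
    exact this.mono_left nhdsWithin_le_nhds

theorem integral_abs_exp_sub_exp_div {a b : ℝ} (ha : 0 < a) (hb : 0 < b) :
    ∫ t in Set.Ioi (0 : ℝ), |t⁻¹ * (Real.exp (-(a * t)) - Real.exp (-(b * t)))|
      = |Real.log (b / a)| := by
  wlog hab : a ≤ b generalizing a b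
  · have h := this hb ha (le_of_not_ge hab)
    rw [← inv_div, Real.log_inv, abs_neg, ← h]
    congr 1
    funext t
    rw [abs_mul, abs_mul, abs_sub_comm]
  rw [abs_of_nonneg (Real.log_nonneg ((one_le_div ha).2 hab)), ← integral_exp_sub_exp_div ha hb]
  refine setIntegral_congr_fun measurableSet_Ioi fun t ht => ?_
  have ht0 : (0 : ℝ) < t := ht
  have h1 : Real.exp (-(b * t)) ≤ Real.exp (-(a * t)) :=
    Real.exp_le_exp.2 (neg_le_neg (mul_le_mul_of_nonneg_right hab ht0.le))
  exact abs_of_nonneg (mul_nonneg (inv_nonneg.2 ht0.le) (sub_nonneg.2 h1))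

theorem integrable_exp_neg_mul_norm_sq {b : ℝ} (hb : 0 < b) :
    Integrable fun z : Plane => Real.exp (-b * ‖z‖ ^ 2) := by
  have h := GaussianFourier.integral_rexp_neg_mul_sq_norm (V := Plane) hb
  refine Integrable.of_integral_ne_zero ?_
  rw [h]
  positivity

/-- The Gaussian kernel is positive semidefinite. -/
theorem integral_gaussian_mul_nonneg {a : Plane → ℝ} (ha : Integrable a) {t : ℝ} (ht : 0 < t) :
    0 ≤ ∫ p : Plane × Plane, Real.exp (-(‖p.1 - p.2‖ ^ 2 * t)) * (a p.1 * a p.2)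
      ∂(volume.prod volume) := by
  have hb : 0 < 4 * t := by linarith
  set C : ℝ := ∫ z : Plane, Real.exp (-(4 * t) * ‖z‖ ^ 2)
  have hC : 0 < C := by
    simp only [C]
    rw [GaussianFourier.integral_rexp_neg_mul_sq_norm hb]
    positivity
  have hgi := integrable_exp_neg_mul_norm_sq hb
  let G : Plane → Plane → ℝ := fun x z => Real.exp (-(2 * t) * ‖x - z‖ ^ 2)
  have hGG : ∀ (p : Plane × Plane) (z : Plane), G p.1 z * G p.2 z
      = Real.exp (-(‖p.1 - p.2‖ ^ 2 * t))
        * Real.exp (-(4 * t) * ‖z - (2⁻¹ : ℝ) • (p.1 + p.2)‖ ^ 2) := by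
    intro p z
    simp only [G]
    rw [← Real.exp_add, ← Real.exp_add]
    congr 1
    have h := parallelogram_law_with_norm ℝ (p.1 - z) (p.2 - z)
    have e1 : p.1 - z + (p.2 - z) = (-2 : ℝ) • (z - (2⁻¹ : ℝ) • (p.1 + p.2)) := by
      module
    have e2 : p.1 - z - (p.2 - z) = p.1 - p.2 := by abel
    have e3 : ‖(-2 : ℝ)‖ = 2 := by norm_num
    rw [e1, e2, norm_smul, e3] at h
    linear_combination t * h
  let F : Plane × Plane → Plane → ℝ := fun p z => G p.1 z * G p.2 z * (a p.1 * a p.2)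
  have hA : Integrable (fun p : Plane × Plane => a p.1 * a p.2) (volume.prod volume) :=
    ha.mul_prod ha
  have hFz : ∀ p, ∫ z, F p z = C * (Real.exp (-(‖p.1 - p.2‖ ^ 2 * t)) * (a p.1 * a p.2)) := by
    intro p
    simp only [F, hGG]
    rw [integral_mul_const, integral_const_mul,
      integral_sub_right_eq_self (fun z : Plane => Real.exp (-(4 * t) * ‖z‖ ^ 2))]
    ring
  have hGc : Continuous fun w : (Plane × Plane) × Plane => G w.1.1 w.2 * G w.1.2 w.2 := by
    simp only [G]
    fun_prop
  have hFm : AEStronglyMeasurable (Function.uncurry F) ((volume.prod volume).prod volume) :=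
    hGc.aestronglyMeasurable.mul hA.1.comp_fst
  have hexp : ∀ p : Plane × Plane, Real.exp (-(‖p.1 - p.2‖ ^ 2 * t)) ≤ 1 := fun p =>
    Real.exp_le_one_iff.2 (neg_nonpos.2 (by positivity))
  have hFi : Integrable (Function.uncurry F) ((volume.prod volume).prod volume) := by
    rw [integrable_prod_iff hFm]
    refine ⟨Filter.Eventually.of_forall fun p => ?_, ?_⟩
    · simp only [Function.uncurry_apply_pair, F, hGG]
      exact ((hgi.comp_sub_right _).const_mul _).mul_const _
    · have e : ∀ p, ∫ z, ‖Function.uncurry F (p, z)‖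
          = C * (Real.exp (-(‖p.1 - p.2‖ ^ 2 * t)) * ‖a p.1 * a p.2‖) := by
        intro p
        simp only [Function.uncurry_apply_pair, F, hGG]
        simp only [norm_mul _ (a p.1 * a p.2), Real.norm_of_nonneg (mul_nonneg (Real.exp_nonneg _)
          (Real.exp_nonneg _))]
        rw [integral_mul_const, integral_const_mul,
          integral_sub_right_eq_self (fun z : Plane => Real.exp (-(4 * t) * ‖z‖ ^ 2))]
        ring
      simp only [e]
      refine (hA.norm.bdd_mul (c := 1) ?_ (Filter.Eventually.of_forall fun p => ?_)).const_mul C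
      · exact (by fun_prop : Continuous fun p : Plane × Plane =>
          Real.exp (-(‖p.1 - p.2‖ ^ 2 * t))).aestronglyMeasurable
      · rw [Real.norm_of_nonneg (Real.exp_nonneg _)]
        exact hexp p
  have hswap := integral_integral_swap hFi
  have hFp : ∀ z, ∫ p : Plane × Plane, F p z ∂(volume.prod volume)
      = (∫ x, G x z * a x) * ∫ x, G x z * a x := by
    intro z
    rw [← integral_prod_mul]
    congr 1
    funext p
    simp only [F]
    ring
  simp only [hFz, hFp, integral_const_mul] at hswap
  have hnn : 0 ≤ ∫ z, (∫ x, G x z * a x) * ∫ x, G x z * a x :=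
    integral_nonneg fun z => mul_self_nonneg _
  rw [← hswap] at hnn
  exact nonneg_of_mul_nonneg_right hnn hC

/-- The logarithmic energy of a mean-zero density on the plane has a sign. -/
theorem integral_log_mul_nonpos {a : Plane → ℝ} (ha : Integrable a) (h0 : ∫ x, a x = 0)
    (hl : Integrable (fun p : Plane × Plane => Real.log ‖p.1 - p.2‖ * (a p.1 * a p.2))
      (volume.prod volume)) :
    ∫ p : Plane × Plane, Real.log ‖p.1 - p.2‖ * (a p.1 * a p.2) ∂(volume.prod volume) ≤ 0 := by
  have hA : Integrable (fun p : Plane × Plane => a p.1 * a p.2) (volume.prod volume) :=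
    ha.mul_prod ha
  let k : Plane × Plane → ℝ → ℝ := fun p t =>
    t⁻¹ * (Real.exp (-(‖p.1 - p.2‖ ^ 2 * t)) - Real.exp (-(1 * t)))
  let F : Plane × Plane → ℝ → ℝ := fun p t => k p t * (a p.1 * a p.2)
  have hne : ∀ᵐ p : Plane × Plane ∂(volume.prod volume), p.1 ≠ p.2 := by
    refine (Measure.ae_prod_iff_ae_ae (p := fun p : Plane × Plane => p.1 ≠ p.2)
      (measurableSet_eq_fun measurable_fst measurable_snd).compl).2 ?_
    exact Filter.Eventually.of_forall fun x => (Measure.ae_ne volume x).mono fun y hy => hy.symm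
  have hpos : ∀ p : Plane × Plane, p.1 ≠ p.2 → 0 < ‖p.1 - p.2‖ ^ 2 := fun p hp =>
    pow_pos (norm_pos_iff.2 (sub_ne_zero.2 hp)) 2
  have hlog : ∀ p : Plane × Plane,
      Real.log (1 / ‖p.1 - p.2‖ ^ 2) = -2 * Real.log ‖p.1 - p.2‖ := by
    intro p
    rw [one_div, Real.log_inv, Real.log_pow]
    push_cast
    ring
  have hkm : Measurable fun w : (Plane × Plane) × ℝ => k w.1 w.2 := by
    simp only [k]
    fun_prop
  have hFm : AEStronglyMeasurable (Function.uncurry F)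
      ((volume.prod volume).prod (volume.restrict (Set.Ioi 0))) :=
    hkm.aestronglyMeasurable.mul hA.1.comp_fst
  have hFi : Integrable (Function.uncurry F)
      ((volume.prod volume).prod (volume.restrict (Set.Ioi 0))) := by
    rw [integrable_prod_iff hFm]
    refine ⟨hne.mono fun p hp => ?_, (hl.norm.const_mul 2).congr (hne.mono fun p hp => ?_)⟩
    · exact (integrableOn_exp_sub_exp_div (hpos p hp) one_pos).mul_const (a p.1 * a p.2)
    · simp only [Function.uncurry_apply_pair, F, norm_mul _ (a p.1 * a p.2)]
      rw [integral_mul_const]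
      simp only [k, Real.norm_eq_abs]
      rw [integral_abs_exp_sub_exp_div (hpos p hp) one_pos, hlog, abs_mul]
      norm_num
      ring
  have hswap := integral_integral_swap hFi
  have hL : ∫ p, ∫ t in Set.Ioi 0, F p t ∂volume ∂(volume.prod volume)
      = -2 * ∫ p : Plane × Plane, Real.log ‖p.1 - p.2‖ * (a p.1 * a p.2)
        ∂(volume.prod volume) := by
    rw [← integral_const_mul]
    refine integral_congr_ae (hne.mono fun p hp => ?_)
    simp only [F, k]
    rw [integral_mul_const, integral_exp_sub_exp_div (hpos p hp) one_pos, hlog]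
    ring
  have hR : 0 ≤ ∫ t in Set.Ioi 0, ∫ p, F p t ∂(volume.prod volume) := by
    refine setIntegral_nonneg measurableSet_Ioi fun t ht => ?_
    have ht0 : (0 : ℝ) < t := ht
    have hg : Integrable (fun p : Plane × Plane =>
        Real.exp (-(‖p.1 - p.2‖ ^ 2 * t)) * (a p.1 * a p.2)) (volume.prod volume) := by
      refine hA.bdd_mul (c := 1) ?_ (Filter.Eventually.of_forall fun p => ?_)
      · exact (by fun_prop : Continuous fun p : Plane × Plane =>
          Real.exp (-(‖p.1 - p.2‖ ^ 2 * t))).aestronglyMeasurable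
      · rw [Real.norm_of_nonneg (Real.exp_nonneg _)]
        exact Real.exp_le_one_iff.2 (neg_nonpos.2 (by positivity))
    have e : ∀ p, F p t = t⁻¹ * (Real.exp (-(‖p.1 - p.2‖ ^ 2 * t)) * (a p.1 * a p.2)
        - Real.exp (-(1 * t)) * (a p.1 * a p.2)) := by
      intro p
      simp only [F, k]
      ring
    simp only [e]
    rw [integral_const_mul, integral_sub hg (hA.const_mul _), integral_const_mul,
      integral_prod_mul, h0, mul_zero, mul_zero, sub_zero]
    exact mul_nonneg (inv_nonneg.2 ht0.le) (integral_gaussian_mul_nonneg ha ht0)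
  rw [← hswap, hL] at hR
  linarith

theorem log_sq_le {r : ℝ} (hr : 0 ≤ r) :
    Real.log r ^ 2 ≤ 4 * (if r < 1 then r⁻¹ else 0) + r ^ 2 := by
  rcases hr.eq_or_lt with rfl | hr0
  · simp
  split_ifs with h1
  · have h := Real.abs_log_mul_self_rpow_lt r (1 / 2) hr0 h1.le (by norm_num)
    have hs : r ^ (1 / 2 : ℝ) * r ^ (1 / 2 : ℝ) = r := by
      rw [← Real.rpow_add hr0]
      norm_num
    have h2 : (Real.log r * r ^ (1 / 2 : ℝ)) ^ 2 < 4 := by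
      rw [← sq_abs]
      nlinarith [abs_nonneg (Real.log r * r ^ (1 / 2 : ℝ))]
    have h3 : Real.log r ^ 2 * r < 4 := by
      calc Real.log r ^ 2 * r = (Real.log r * r ^ (1 / 2 : ℝ)) ^ 2 := by
            rw [mul_pow, sq (r ^ (1 / 2 : ℝ)), hs]
        _ < 4 := h2
    have h4 : Real.log r ^ 2 ≤ 4 * r⁻¹ := by
      rw [← div_eq_mul_inv, le_div_iff₀ hr0]
      exact h3.le
    nlinarith [sq_nonneg r]
  · have h2 := Real.log_le_self hr
    have h3 := Real.log_nonneg (not_lt.1 h1)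
    nlinarith

theorem DecayingPotential.le_div_pow {V : Plane → ℝ} {β : ℝ} (hβ : 10 < β)
    (hV : DecayingPotential V β) :
    ∃ c : ℝ, 0 < c ∧ ∀ x : Plane, |V x| ≤ c / (1 + ‖x‖ ^ 2) ^ 5 := by
  obtain ⟨-, c, hc, h⟩ := hV
  refine ⟨c, hc, fun x => ?_⟩
  have h1 : (1 : ℝ) ≤ 1 + ‖x‖ ^ 2 := by nlinarith [sq_nonneg ‖x‖]
  have hj : 1 ≤ japaneseBracket x := Real.one_le_sqrt.2 h1
  have h2 : (1 + ‖x‖ ^ 2) ^ 5 ≤ japaneseBracket x ^ β := by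
    calc (1 + ‖x‖ ^ 2) ^ 5 = japaneseBracket x ^ (10 : ℝ) := by
          rw [← Real.sq_sqrt (by linarith : 0 ≤ 1 + ‖x‖ ^ 2)]
          change (japaneseBracket x ^ 2) ^ 5 = _
          rw [← pow_mul]
          norm_cast
      _ ≤ japaneseBracket x ^ β := Real.rpow_le_rpow_of_exponent_le hj hβ.le
  calc |V x| ≤ |V x| + |inner ℝ x (gradient V x)| := le_add_of_nonneg_right (abs_nonneg _)
    _ ≤ c / japaneseBracket x ^ β := h x
    _ ≤ c / (1 + ‖x‖ ^ 2) ^ 5 := by gcongr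

theorem integrable_one_div_one_add_norm_sq_sq :
    Integrable fun x : Plane => 1 / (1 + ‖x‖ ^ 2) ^ 2 := by
  have h : Integrable fun x : Plane => ((1 : ℝ) + ‖x‖ ^ 2) ^ (-4 / 2 : ℝ) :=
    integrable_rpow_neg_one_add_norm_sq (by simp; norm_num)
  refine h.congr (Filter.Eventually.of_forall fun x => ?_)
  have h0 : (0 : ℝ) ≤ 1 + ‖x‖ ^ 2 := by positivity
  have e : (-4 / 2 : ℝ) = -((2 : ℕ) : ℝ) := by norm_num
  simp only [e]
  rw [Real.rpow_neg h0, Real.rpow_natCast, one_div]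

section Decay

variable {V : Plane → ℝ} {c : ℝ}

theorem integrable_of_decay (hV : Continuous V) (hc : 0 < c)
    (h : ∀ x : Plane, |V x| ≤ c / (1 + ‖x‖ ^ 2) ^ 5) :
    Integrable fun x => |V x| * (1 + ‖x‖ ^ 2) := by
  refine (integrable_one_div_one_add_norm_sq_sq.const_mul c).mono' (by fun_prop)
    (Filter.Eventually.of_forall fun x => ?_)
  have h1 : (1 : ℝ) ≤ 1 + ‖x‖ ^ 2 := by nlinarith [sq_nonneg ‖x‖]
  rw [Real.norm_of_nonneg (by positivity)]
  calc |V x| * (1 + ‖x‖ ^ 2) ≤ c / (1 + ‖x‖ ^ 2) ^ 5 * (1 + ‖x‖ ^ 2) := by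
        gcongr
        exact h x
    _ = c / (1 + ‖x‖ ^ 2) ^ 4 := by field_simp
    _ ≤ c / (1 + ‖x‖ ^ 2) ^ 2 := by
        gcongr
        norm_num
    _ = c * (1 / (1 + ‖x‖ ^ 2) ^ 2) := by ring

theorem integrable_abs_of_decay (hV : Continuous V) (hc : 0 < c)
    (h : ∀ x : Plane, |V x| ≤ c / (1 + ‖x‖ ^ 2) ^ 5) : Integrable fun x => |V x| := by
  refine (integrable_of_decay hV hc h).mono' hV.abs.aestronglyMeasurable
    (Filter.Eventually.of_forall fun x => ?_)
  rw [Real.norm_of_nonneg (abs_nonneg _)]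
  nlinarith [abs_nonneg (V x), sq_nonneg ‖x‖, mul_nonneg (abs_nonneg (V x)) (sq_nonneg ‖x‖)]

theorem integrable_inv_norm_near_zero :
    Integrable fun z : Plane => if ‖z‖ < 1 then ‖z‖⁻¹ else 0 := by
  have h : IntegrableOn (fun z : Plane => ‖z‖⁻¹) (Metric.ball 0 1) volume := by
    refine integrableOn_ball_of_norm_le_rpow (by simp) (C := 1) (α := 1) (by simp)
      (Filter.Eventually.of_forall fun z => ?_) (by fun_prop)
    rw [Real.rpow_neg_one, one_mul, norm_inv, norm_norm]
  refine (h.integrable_indicator measurableSet_ball).congr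
    (Filter.Eventually.of_forall fun z => ?_)
  by_cases hz : ‖z‖ < 1
  · rw [Set.indicator_of_mem (by simpa using hz)]
    exact (if_pos hz).symm
  · rw [Set.indicator_of_notMem (by simpa using hz)]
    exact (if_neg hz).symm

/-- The kernel of `v log|x - y| v`. -/
noncomputable def sandwichedLog (V : Plane → ℝ) (p : Plane × Plane) : ℝ :=
  √|V p.1| * Real.log ‖p.1 - p.2‖ * √|V p.2|

theorem memLp_sandwichedLog (hV : Continuous V) (hc : 0 < c)
    (h : ∀ x : Plane, |V x| ≤ c / (1 + ‖x‖ ^ 2) ^ 5) :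
    MemLp (sandwichedLog V) 2 (volume.prod volume) := by
  have hm : Measurable (sandwichedLog V) := by
    have := hV.measurable
    unfold sandwichedLog
    fun_prop
  rw [memLp_two_iff_integrable_sq hm.aestronglyMeasurable]
  have hVc : ∀ x, |V x| ≤ c := fun x => (h x).trans (div_le_self hc.le
    (one_le_pow₀ (by nlinarith [sq_nonneg ‖x‖])))
  have i1 := (integrable_abs_of_decay hV hc h).convolution_integrand
    (ContinuousLinearMap.mul ℝ ℝ) integrable_inv_norm_near_zero
  have i2 := (integrable_of_decay hV hc h).mul_prod (integrable_of_decay hV hc h)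
  refine ((i1.const_mul (4 * c)).add (i2.const_mul 2)).mono' (hm.pow_const 2).aestronglyMeasurable
    (Filter.Eventually.of_forall fun p => ?_)
  rw [Real.norm_of_nonneg (sq_nonneg _)]
  simp only [sandwichedLog, Pi.add_apply, ContinuousLinearMap.mul_apply']
  rw [mul_pow, mul_pow, Real.sq_sqrt (abs_nonneg _), Real.sq_sqrt (abs_nonneg _)]
  set w : ℝ := if ‖p.1 - p.2‖ < 1 then ‖p.1 - p.2‖⁻¹ else 0
  have hw : 0 ≤ w := by
    simp only [w]
    split_ifs <;> positivity
  have hr : ‖p.1 - p.2‖ ^ 2 ≤ 2 * ((1 + ‖p.1‖ ^ 2) * (1 + ‖p.2‖ ^ 2)) := by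
    have h1 := norm_sub_le p.1 p.2
    nlinarith [norm_nonneg (p.1 - p.2), sq_nonneg (‖p.1‖ - ‖p.2‖),
      mul_nonneg (sq_nonneg ‖p.1‖) (sq_nonneg ‖p.2‖), norm_nonneg p.1, norm_nonneg p.2]
  calc |V p.1| * Real.log ‖p.1 - p.2‖ ^ 2 * |V p.2|
      ≤ |V p.1| * (4 * w + 2 * ((1 + ‖p.1‖ ^ 2) * (1 + ‖p.2‖ ^ 2))) * |V p.2| := by
        gcongr
        exact (log_sq_le (norm_nonneg _)).trans (by gcongr)
    _ = |V p.1| * (4 * (|V p.2| * w))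
        + 2 * (|V p.1| * (1 + ‖p.1‖ ^ 2) * (|V p.2| * (1 + ‖p.2‖ ^ 2))) := by ring
    _ ≤ c * (4 * (|V p.2| * w))
        + 2 * (|V p.1| * (1 + ‖p.1‖ ^ 2) * (|V p.2| * (1 + ‖p.2‖ ^ 2))) := by
        gcongr
        exact hVc _
    _ = _ := by ring

theorem memLp_sqrt_abs (hV : Continuous V) (hc : 0 < c)
    (h : ∀ x : Plane, |V x| ≤ c / (1 + ‖x‖ ^ 2) ^ 5) :
    MemLp (fun x => √|V x|) 2 volume := by
  rw [memLp_two_iff_integrable_sq hV.abs.sqrt.aestronglyMeasurable]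
  simpa only [Real.sq_sqrt (abs_nonneg _)] using integrable_abs_of_decay hV hc h

theorem integrable_sandwichedLog_mul (hV : Continuous V) (hc : 0 < c)
    (h : ∀ x : Plane, |V x| ≤ c / (1 + ‖x‖ ^ 2) ^ 5) {b : Plane → ℝ} (hb : MemLp b 2 volume) :
    Integrable (fun p => sandwichedLog V p * (b p.1 * b p.2)) (volume.prod volume) := by
  have hbb : MemLp (fun p : Plane × Plane => b p.1 * b p.2) 2 (volume.prod volume) := by
    refine (memLp_two_iff_integrable_sq (hb.1.comp_fst.mul hb.1.comp_snd)).2 ?_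
    simpa only [Pi.mul_apply, mul_pow] using hb.integrable_sq.mul_prod hb.integrable_sq
  exact (memLp_sandwichedLog hV hc h).integrable_mul hbb

theorem integral_sandwichedLog_mul_nonpos (hV : Continuous V) (hc : 0 < c)
    (h : ∀ x : Plane, |V x| ≤ c / (1 + ‖x‖ ^ 2) ^ 5) {b : Plane → ℝ} (hb : MemLp b 2 volume)
    (h0 : ∫ x, √|V x| * b x = 0) :
    ∫ p, sandwichedLog V p * (b p.1 * b p.2) ∂(volume.prod volume) ≤ 0 := by
  have e : ∀ p : Plane × Plane, sandwichedLog V p * (b p.1 * b p.2)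
      = Real.log ‖p.1 - p.2‖ * ((√|V p.1| * b p.1) * (√|V p.2| * b p.2)) := fun p => by
    simp only [sandwichedLog]
    ring
  have hi := integrable_sandwichedLog_mul hV hc h hb
  simp only [e] at hi ⊢
  exact integral_log_mul_nonpos ((memLp_sqrt_abs hV hc h).integrable_mul hb) h0 hi

/-- On the orthogonal complement of `v`, the operator `v G₀ v` is nonnegative. -/
theorem re_inner_integral_kernel_nonneg (hV : Continuous V) (hc : 0 < c)
    (h : ∀ x : Plane, |V x| ≤ c / (1 + ‖x‖ ^ 2) ^ 5)
    {f g : Lp ℂ 2 (volume : Measure Plane)} (h0 : ∫ x, (√|V x| : ℂ) * f x = 0)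
    (hg : g =ᵐ[volume] fun x =>
      ∫ y, ((-(1 / (2 * Real.pi)) * sandwichedLog V (x, y) : ℝ) : ℂ) * f y) :
    0 ≤ (inner ℂ f g).re := by
  set s : ℝ := 1 / (2 * Real.pi)
  have hs : 0 ≤ s := by positivity
  have hf := Lp.memLp f
  have hfr : MemLp (fun x => (f x).re) 2 volume := hf.re
  have hfi : MemLp (fun x => (f x).im) 2 volume := hf.im
  have hvf : Integrable fun x => (√|V x| : ℂ) * f x :=
    MemLp.integrable_mul (memLp_sqrt_abs hV hc h).ofReal hf
  have hr0 : ∫ x, √|V x| * (f x).re = 0 := by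
    have := integral_re hvf
    rw [h0] at this
    simpa using this
  have hi0 : ∫ x, √|V x| * (f x).im = 0 := by
    have := integral_im hvf
    rw [h0] at this
    simpa using this
  have hff : MemLp (fun p : Plane × Plane => f p.2 * (starRingEnd ℂ) (f p.1)) 2
      (volume.prod volume) := by
    have hstar : MemLp (fun x => (starRingEnd ℂ) (f x)) 2 volume := hf.star
    refine (memLp_two_iff_integrable_sq_norm (hf.1.comp_snd.mul hstar.1.comp_fst)).2 ?_
    have hsq := (memLp_two_iff_integrable_sq_norm hf.1).1 hf
    refine (hsq.mul_prod hsq).congr (Filter.Eventually.of_forall fun p => ?_)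
    simp only [Pi.mul_apply, norm_mul, mul_pow, RCLike.norm_conj]
    exact mul_comm _ _
  have hK : MemLp (fun p => ((-s * sandwichedLog V p : ℝ) : ℂ)) 2 (volume.prod volume) :=
    ((memLp_sandwichedLog hV hc h).const_mul (-s)).ofReal
  have hint : Integrable (fun p : Plane × Plane => ((-s * sandwichedLog V p : ℝ) : ℂ)
      * (f p.2 * (starRingEnd ℂ) (f p.1))) (volume.prod volume) := hK.integrable_mul hff
  have e1 : inner ℂ f g = ∫ p : Plane × Plane, ((-s * sandwichedLog V p : ℝ) : ℂ)
      * (f p.2 * (starRingEnd ℂ) (f p.1)) ∂(volume.prod volume) := by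
    rw [L2.inner_def, integral_prod _ hint]
    refine integral_congr_ae (hg.mono fun x hx => ?_)
    simp only [hx, RCLike.inner_apply]
    rw [← integral_mul_const]
    congr 1
    funext y
    ring
  have ir := integrable_sandwichedLog_mul hV hc h hfr
  have ii := integrable_sandwichedLog_mul hV hc h hfi
  have e2 : (inner ℂ f g).re = -s * ((∫ p, sandwichedLog V p * ((f p.1).re * (f p.2).re)
      ∂(volume.prod volume)) + ∫ p, sandwichedLog V p * ((f p.1).im * (f p.2).im)
      ∂(volume.prod volume)) := by
    rw [e1, ← integral_add ir ii, ← integral_const_mul]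
    refine (integral_re hint).symm.trans ?_
    congr 1
    funext p
    rw [RCLike.re_to_complex, Complex.re_ofReal_mul]
    simp
    ring
  rw [e2]
  have := integral_sandwichedLog_mul_nonpos hV hc h hfr hr0
  have := integral_sandwichedLog_mul_nonpos hV hc h hfi hi0
  nlinarith

theorem zeroIsRegularPoint_of_nonneg (hV : Continuous V) (hV0 : ∀ x, 0 ≤ V x) (hc : 0 < c)
    (h : ∀ x : Plane, |V x| ≤ c / (1 + ‖x‖ ^ 2) ^ 5) : ZeroIsRegularPoint V := by
  have hv : MemLp (sqrtAbs V) 2 volume := (memLp_sqrt_abs hV hc h).ofReal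
  have hK : MemLp (fun p => ((-(1 / (2 * Real.pi)) * sandwichedLog V p : ℝ) : ℂ)) 2
      (volume.prod volume) := ((memLp_sandwichedLog hV hc h).const_mul _).ofReal
  obtain ⟨K, hKf⟩ := exists_clm_integral_kernel hK
  refine ⟨hv, 1 + K, fun f => ?_, ?_⟩
  · rw [add_apply, one_apply_eq_self]
    filter_upwards [Lp.coeFn_add f (K f), hKf f] with x hx hKx
    rw [hx, Pi.add_apply, hKx, potentialSign, if_pos (hV0 x), one_mul, logPotential,
      ← integral_const_mul, ← integral_const_mul]
    congr 2
    funext y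
    simp only [sandwichedLog, sqrtAbs]
    push_cast
    ring
  · refine ContinuousLinearMap.isUnit_of_forall_le_norm_inner_map _ (c := 1) one_pos fun f => ?_
    have hperp : ∫ x, (√|V x| : ℂ) * (f : Lp ℂ 2 (volume : Measure Plane)) x = 0 := by
      have h1 := Submodule.mem_orthogonal_singleton_iff_inner_right.1 f.2
      rw [L2.inner_def] at h1
      rw [← h1]
      refine integral_congr_ae (hv.coeFn_toLp.mono fun x hx => ?_)
      simp only [hx, RCLike.inner_apply, sqrtAbs, Complex.conj_ofReal]
      exact mul_comm _ _
    have hpos := re_inner_integral_kernel_nonneg hV hc h hperp (hKf f)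
    rw [NNReal.coe_one, mul_one, ContinuousLinearMap.comp_apply,
      Submodule.inner_orthogonalProjectionOnto_eq_of_mem_right]
    refine le_trans ?_ (Complex.re_le_norm _)
    rw [← Complex.conj_re, inner_conj_symm]
    simp only [ContinuousLinearMap.comp_apply, Submodule.subtypeL_apply,
      add_apply, one_apply_eq_self, inner_add_right,
      Complex.add_re]
    have hn := inner_self_eq_norm_sq (𝕜 := ℂ) (f : Lp ℂ 2 (volume : Measure Plane))
    rw [RCLike.re_to_complex] at hn
    rw [hn]
    simpa using hpos

end Decay

theorem mainTheorem11 (V : Plane → ℝ) (β : ℝ) (hβ : 10 < β) (hV : DecayingPotential V β)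
    (hV_nonneg : ∀ x, 0 ≤ V x) (hV_ne : V ≠ 0) :
    (∀ (c₀ : ℂ) (Ψ₀ : Plane → ℂ), IsResonanceSolution V c₀ Ψ₀ →
        (fun x => c₀ + Ψ₀ x) =ᵐ[volume] 0) ∧
      ¬ ZeroIsResonance V ∧
      ZeroIsRegularPoint V := by
  have hVc : Continuous V := hV.1.continuous
  have hres : ∀ (c₀ : ℂ) (Ψ₀ : Plane → ℂ), IsResonanceSolution V c₀ Ψ₀ →
      (fun x => c₀ + Ψ₀ x) =ᵐ[volume] 0 := fun _ _ h => h.ae_eq_zero hVc hV_nonneg hV_ne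
  obtain ⟨c, hc, hdecay⟩ := hV.le_div_pow hβ
  exact ⟨hres, fun ⟨c₀, Ψ₀, h, hne⟩ => hne (hres c₀ Ψ₀ h),
    zeroIsRegularPoint_of_nonneg hVc hV_nonneg hc hdecay⟩
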